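/- **Maps.** A rooted map is a connected finite graph (loops and multiple edges allowed) with at least one edge, cellularly embedded in an oriented closed surface of arbitrary genus, with a marked corner; the root half-edge is the one following the root corner in clockwise order around the root vertex. Maps are considered up to root-preserving isomorphism. A map is Eulerian if all its vertex degrees are even; an Eulerian orientation is one in which each vertex has outdegree equal to half its degree. A marked map is a rooted map in which some edges are marked and oriented; an orientation of it is compatible if it agrees with the fixed orientations of the marked edges, and a compatible orientation is root-accessible if from each vertex there is an oriented path to the root vertex avoiding the marked edges. A marked Eulerian map is admissible if it has a compatible, root-accessible Eulerian orientation in which the root half-edge is outgoing. For $a\ge 0$ let $\mathcal M_a$ be the set of admissible marked Eulerian maps with exactly $a$ marked edges. **Trees.** All trees are plane trees; vertices of degree $1$ are leaves, the others are nodes. A blossoming tree is a plane tree with a marked leaf (the root leaf), whose leaves are of two kinds, opening and closing, with equally many of each and with the root leaf opening. It is an Eulerian tree if every node has even degree and each node of degree $2k$ has exactly $k-1$ adjacent opening leaves, not counting the root leaf. A marked matching is a perfect matching of the opening leaves with the closing leaves in which some pairs are marked, such that in each unmarked pair the opening leaf precedes the closing leaf in the clockwise walk around the tree starting at (and including) the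 root leaf. For $a\ge 0$ let $\mathcal U_a$ be the set of Eulerian trees with at least one node, endowed with a marked matching with exactly $a$ marked pairs (up to root-preserving isomorphism). **Canonical orientation and tree.** For a marked Eulerian map $M$, a pair $(O,T)$ is called canonical if $O$ is a compatible Eulerian orientation of $M$ and $T$ is a spanning tree of $M$ without marked edges, such that the edges of $T$ are directed in $O$ toward the root vertex along $T$, and for each unmarked edge not in $T$ the outgoing half in $O$ is the half-edge that comes first in the clockwise walk around $T$ starting at the root corner (the marked edges being ignored). **Proposition.** Let $a\ge 0$. Each $M\in\mathcal M_a$ has exactly one canonical pair $(O,T)$ (its canonical Eulerian orientation and its canonical spanning tree), and there is a bijection between $\mathcal U_a$ and $\mathcal M_a$ under which $M\in\mathcal M_a$ corresponds to the tree obtained by cutting at its middle each edge of $M$ not in $T$, where the end of the outgoing (resp. ingoing) half is an opening (resp. closing) leaf, the two leaves coming from the same edge are matched, the pair is marked if and only if the edge is marked, and the root leaf is the one at the end of the root half-edge. Moreover, for each $k$, the number of nodes of degree $2k$ of the tree equals the number of vertices of degree $2k$ of the map. -/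

import Mathlib

/-- A finite rooted combinatorial map, not yet required to be connected.  `H` is the set of
half-edges, `σ h` is the next half-edge after `h` in clockwise order around the vertex of `h`,
`opp h` is the other half of the edge of `h`, and `root` is the half-edge that follows the root
corner in clockwise order.  Vertices are the cycles of `σ`; loops and multiple edges are allowed. -/
structure HalfEdgeMap : Type 1 where
  H : Type
  finite : Finite H
  σ : Equiv.Perm H
  opp : H → H
  opp_opp : ∀ h, opp (opp h) = h
  opp_ne : ∀ h, opp h ≠ h
  root : H

/-- The sequence `r, f r, f (f r), ...` meets `x` strictly before it (possibly) meets `y`. -/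
def VisitedBefore {X : Type} (f : X → X) (r x y : X) : Prop :=
  ∃ n : ℕ, f^[n] r = x ∧ ∀ m ≤ n, f^[m] r ≠ y

namespace HalfEdgeMap

/-- The vertices are the cycles of the clockwise rotation `σ`. -/
def Vertex (M : HalfEdgeMap) : Type := Quotient (Equiv.Perm.SameCycle.setoid M.σ)

/-- The vertex incident to a half-edge. -/
def vert (M : HalfEdgeMap) (h : M.H) : M.Vertex :=
  Quotient.mk (Equiv.Perm.SameCycle.setoid M.σ) h

def rootVertex (M : HalfEdgeMap) : M.Vertex := M.vert M.root

/-- The degree of a vertex (a loop counts twice). -/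
noncomputable def degree (M : HalfEdgeMap) (v : M.Vertex) : ℕ := {h | M.vert h = v}.ncard

/-- One can go from `u` to `v` along an edge, starting with a half-edge at `u` that lies in `S`. -/
def Step (M : HalfEdgeMap) (S : Set M.H) (u v : M.Vertex) : Prop :=
  ∃ h ∈ S, M.vert h = u ∧ M.vert (M.opp h) = v

/-- There is a path from `u` to `v` leaving each visited vertex through a half-edge in `S`. If `S`
is the set of outgoing half-edges of an orientation, this is an oriented path; if `S` is
closed under `opp`, this is a path using edges of `S` only. -/
def Reaches (M : HalfEdgeMap) (S : Set M.H) (u v : M.Vertex) : Prop :=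
  Relation.ReflTransGen (M.Step S) u v

def IsConnected (M : HalfEdgeMap) : Prop := ∀ u v, M.Reaches Set.univ u v

/-- A spanning tree, given as the set `T` of the half-edges of its edges: it connects all the
vertices, and its number of edges is one less than the number of vertices. -/
structure IsSpanningTree (M : HalfEdgeMap) (T : Set M.H) : Prop where
  opp_mem_iff : ∀ h, M.opp h ∈ T ↔ h ∈ T
  connects : ∀ u v, M.Reaches T u v
  card_eq : T.ncard + 2 = 2 * Nat.card M.Vertex

/-- The map is a plane tree. -/
def IsTree (M : HalfEdgeMap) : Prop := M.IsSpanningTree Set.univ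

open Classical in
/-- One step of the clockwise walk around the set of edges `T`: the walk follows the edges of `T`
and passes across the other half-edges. -/
noncomputable def walk (M : HalfEdgeMap) (T : Set M.H) (h : M.H) : M.H :=
  if h ∈ T then M.σ (M.opp h) else M.σ h

/-- An orientation of the edges, given as the set `O` of outgoing half-edges: each edge has
exactly one outgoing half (at its origin); the other half is ingoing. -/
def IsOrientation (M : HalfEdgeMap) (O : Set M.H) : Prop := ∀ h, M.opp h ∈ O ↔ h ∉ O

noncomputable def outDegree (M : HalfEdgeMap) (O : Set M.H) (v : M.Vertex) : ℕ :=
  {h | h ∈ O ∧ M.vert h = v}.ncard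

/-- An `α`-orientation: every vertex `v` has outdegree `α v`. -/
def IsAlphaOrientation (M : HalfEdgeMap) (α : M.Vertex → ℕ) (O : Set M.H) : Prop :=
  M.IsOrientation O ∧ ∀ v, M.outDegree O v = α v

noncomputable def halfDegree (M : HalfEdgeMap) (v : M.Vertex) : ℕ := M.degree v / 2

/-- An Eulerian map: all degrees are even. -/
def IsEulerian (M : HalfEdgeMap) : Prop := ∀ v, Even (M.degree v)

/-- `e` is an isomorphism of rooted maps. -/
structure IsIso (M N : HalfEdgeMap) (e : M.H ≃ N.H) : Prop where
  map_σ : ∀ h, e (M.σ h) = N.σ (e h)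
  map_opp : ∀ h, e (M.opp h) = N.opp (e h)
  map_root : e M.root = N.root

theorem IsIso.refl (M : HalfEdgeMap) : IsIso M M (Equiv.refl _) := ⟨by simp, by simp, by simp⟩

theorem IsIso.symm {M N : HalfEdgeMap} {e : M.H ≃ N.H} (h : IsIso M N e) :
    IsIso N M e.symm :=
  ⟨fun x => by rw [Equiv.symm_apply_eq, h.map_σ, Equiv.apply_symm_apply],
   fun x => by rw [Equiv.symm_apply_eq, h.map_opp, Equiv.apply_symm_apply],
   by rw [Equiv.symm_apply_eq, h.map_root]⟩

theorem IsIso.trans {M N P : HalfEdgeMap} {e : M.H ≃ N.H} {f : N.H ≃ P.H}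
    (h : IsIso M N e) (k : IsIso N P f) : IsIso M P (e.trans f) :=
  ⟨fun x => by simp [h.map_σ, k.map_σ], fun x => by simp [h.map_opp, k.map_opp],
   by simp [h.map_root, k.map_root]⟩

/-- The number of vertices of degree `d`. -/
noncomputable def vertexCount (M : HalfEdgeMap) (d : ℕ) : ℕ :=
  Nat.card {v : M.Vertex // M.degree v = d}

/-- The half-edge `h` is incident to a leaf, i.e. to a vertex of degree one.  Leaves are identified
with their unique half-edge. -/
def IsLeaf (M : HalfEdgeMap) (h : M.H) : Prop := M.degree (M.vert h) = 1

/-- In a tree, the nodes are the vertices that are not leaves. -/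
def IsNode (M : HalfEdgeMap) (v : M.Vertex) : Prop := M.degree v ≠ 1

/-- The number of nodes of degree `d`. -/
noncomputable def nodeCount (M : HalfEdgeMap) (d : ℕ) : ℕ :=
  Nat.card {v : M.Vertex // M.IsNode v ∧ M.degree v = d}

end HalfEdgeMap

/-- A marked map: a connected rooted map where some edges are marked and oriented. `marked` is
the set of the outgoing half-edges (origins) of the marked edges. -/
structure MarkedMap : Type 1 extends HalfEdgeMap where
  connected : toHalfEdgeMap.IsConnected
  marked : Set H
  opp_notMem_marked : ∀ h ∈ marked, opp h ∉ marked

namespace MarkedMap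

/-- The half-edges of the marked edges (both halves). -/
def markedHalfEdges (M : MarkedMap) : Set M.H := {h | h ∈ M.marked ∨ M.opp h ∈ M.marked}

/-- The orientation agrees with the fixed orientation of the marked edges. -/
def IsCompatible (M : MarkedMap) (O : Set M.H) : Prop := M.marked ⊆ O

/-- From each vertex there is an oriented path to the root vertex avoiding the marked edges. -/
def IsRootAccessible (M : MarkedMap) (O : Set M.H) : Prop :=
  ∀ v, M.Reaches (O \ M.markedHalfEdges) v M.rootVertex

/-- A marked Eulerian map is admissible if it has a compatible root-accessible Eulerian
orientation for which the root half-edge is outgoing. -/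
def IsAdmissible (M : MarkedMap) : Prop :=
  ∃ O, M.IsAlphaOrientation M.halfDegree O ∧ M.IsCompatible O ∧ M.IsRootAccessible O ∧
    M.root ∈ O

/-- `O` and `T` are the canonical `α`-orientation and the canonical spanning tree of `M`:
`O` is a compatible `α`-orientation, `T` is a spanning tree without marked edges, and, after deletion
of the marked edges, `O` is the orientation associated with `T`, i.e. the edges of `T` are
directed toward the root vertex along `T`, and each other unmarked edge has as outgoing half the
one that comes first in the clockwise walk around `T` that starts at the root corner.
(Marked edges are not in `T`, so the walk in the whole map passes across their halves, and it
visits the unmarked half-edges in the same order as the walk in the map without marked edges.) -/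
structure IsCanonical (M : MarkedMap) (α : M.Vertex → ℕ) (O T : Set M.H) : Prop where
  alpha : M.IsAlphaOrientation α O
  compatible : M.IsCompatible O
  spanning : M.IsSpanningTree T
  unmarked : Disjoint T M.markedHalfEdges
  internal : ∀ v, M.Reaches (T ∩ O) v M.rootVertex
  external : ∀ h, h ∉ T → h ∉ M.markedHalfEdges →
    (h ∈ O ↔ VisitedBefore (M.walk T) M.root h (M.opp h))

/-- Isomorphism of marked maps. -/
def Isomorphic (M N : MarkedMap) : Prop :=
  ∃ e : M.H ≃ N.H, M.IsIso N.toHalfEdgeMap e ∧ ∀ h, e h ∈ N.marked ↔ h ∈ M.marked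

end MarkedMap

/-- The admissible marked Eulerian maps with `a` marked edges. -/
def AdmissibleMap (a : ℕ) : Type 1 :=
  {M : MarkedMap // M.IsEulerian ∧ M.IsAdmissible ∧ M.marked.ncard = a}

/-- Maps are considered up to isomorphism. -/
instance AdmissibleMap.setoid (a : ℕ) : Setoid (AdmissibleMap a) where
  r M N := M.1.Isomorphic N.1
  iseqv :=
    { refl := fun M => ⟨Equiv.refl _, .refl _, fun _ => Iff.rfl⟩
      symm := fun ⟨e, h, k⟩ => ⟨e.symm, h.symm, fun x => by
        rw [← k, Equiv.apply_symm_apply]⟩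
      trans := fun ⟨e, h, k⟩ ⟨f, h2, k2⟩ => ⟨e.trans f, h.trans h2, fun x => by
        rw [Equiv.trans_apply, k2, k]⟩ }

/-- The data of a marked blossoming tree: a rooted map together with the set of opening leaves,
the set of matched pairs (opening leaf, closing leaf), and the set of marked pairs. -/
structure BlossomData : Type 1 extends HalfEdgeMap where
  opening : Set H
  pairs : Set (H × H)
  marked : Set (H × H)

namespace BlossomData

/-- The closing leaves are the leaves that are not opening. -/
def closing (t : BlossomData) : Set t.H := {h | t.IsLeaf h ∧ h ∉ t.opening}

/-- A blossoming tree: a plane tree rooted at a leaf, whose leaves are either opening or closing,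
with as many opening as closing leaves, and whose root leaf is opening. -/
structure IsBlossomingTree (t : BlossomData) : Prop where
  tree : t.IsTree
  leaf_of_opening : ∀ h ∈ t.opening, t.IsLeaf h
  root_opening : t.root ∈ t.opening
  card_eq : t.opening.ncard = t.closing.ncard

/-- Every node has some even degree `2 * k` and exactly `k - 1` adjacent opening leaves, not
counting the root leaf. -/
def IsEulerianTree (t : BlossomData) : Prop :=
  ∀ v, t.IsNode v → ∃ k, t.degree v = 2 * k ∧
    {o | o ∈ t.opening ∧ o ≠ t.root ∧ t.vert (t.opp o) = v}.ncard + 1 = k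

/-- A marked matching: a perfect matching of the opening leaves with the closing leaves, some
pairs of which are marked, such that in each unmarked pair the opening leaf comes before the
closing leaf in the clockwise walk around the tree starting at the root leaf. -/
structure IsMarkedMatching (t : BlossomData) : Prop where
  mem : ∀ p ∈ t.pairs, p.1 ∈ t.opening ∧ p.2 ∈ t.closing
  existsUnique_closing : ∀ o ∈ t.opening, ∃! c, (o, c) ∈ t.pairs
  existsUnique_opening : ∀ c ∈ t.closing, ∃! o, (o, c) ∈ t.pairs
  marked_subset : t.marked ⊆ t.pairs
  forward : ∀ p ∈ t.pairs, p ∉ t.marked → VisitedBefore (t.walk Set.univ) t.root p.1 p.2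

/-- Isomorphism of marked blossoming trees. -/
def Isomorphic (s t : BlossomData) : Prop :=
  ∃ e : s.H ≃ t.H, s.IsIso t.toHalfEdgeMap e ∧ (∀ h, e h ∈ t.opening ↔ h ∈ s.opening) ∧
    (∀ o c, (e o, e c) ∈ t.pairs ↔ (o, c) ∈ s.pairs) ∧
    ∀ o c, (e o, e c) ∈ t.marked ↔ (o, c) ∈ s.marked

end BlossomData

/-- The marked Eulerian trees with at least one node and with `a` marked pairs. -/
def MarkedEulerianTree (a : ℕ) : Type 1 :=
  {t : BlossomData // t.IsBlossomingTree ∧ t.IsEulerianTree ∧ t.IsMarkedMatching ∧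
    (∃ v, t.IsNode v) ∧ t.marked.ncard = a}

/-- Trees are considered up to isomorphism. -/
instance MarkedEulerianTree.setoid (a : ℕ) : Setoid (MarkedEulerianTree a) where
  r s t := s.1.Isomorphic t.1
  iseqv :=
    { refl := fun t => ⟨Equiv.refl _, .refl _, fun _ => Iff.rfl, fun _ _ => Iff.rfl,
        fun _ _ => Iff.rfl⟩
      symm := fun ⟨e, h, k, l, m⟩ => ⟨e.symm, h.symm, fun x => by
        rw [← k, Equiv.apply_symm_apply], fun o c => by
        rw [← l, Equiv.apply_symm_apply, Equiv.apply_symm_apply], fun o c => by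
        rw [← m, Equiv.apply_symm_apply, Equiv.apply_symm_apply]⟩
      trans := fun ⟨e, h, k, l, m⟩ ⟨f, h2, k2, l2, m2⟩ => ⟨e.trans f, h.trans h2, fun x => by
        rw [Equiv.trans_apply, k2, k], fun o c => by
        rw [Equiv.trans_apply, Equiv.trans_apply, l2, l], fun o c => by
        rw [Equiv.trans_apply, Equiv.trans_apply, m2, m]⟩ }

open Classical in
/-- Cut in their middles all the edges of `M` that are not in `T`.  Each half-edge `h` outside
`T` gets a new leaf `Sum.inr h` at its end, which is opening if `h` is outgoing and closing if `h` is
ingoing.  The two leaves coming from an edge are matched, the pair is marked if the edge is marked,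
and the root leaf is the one at the end of the root half-edge. -/
noncomputable def MarkedMap.cut (M : MarkedMap) (O T : Set M.H)
    (hT : ∀ h, M.opp h ∈ T ↔ h ∈ T) (hr : M.root ∉ T) : BlossomData where
  H := M.H ⊕ {h : M.H // h ∉ T}
  finite := by
    have := M.finite
    infer_instance
  σ := Equiv.sumCongr M.σ (Equiv.refl _)
  opp := Sum.elim (fun h => if hh : h ∈ T then Sum.inl (M.opp h) else Sum.inr ⟨h, hh⟩)
    (fun x => Sum.inl x.1)
  opp_opp := by
    rintro (h | ⟨h, hh⟩)
    · by_cases hh : h ∈ T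
      · simp [hh, hT, M.opp_opp]
      · simp [hh]
    · simp [hh]
  opp_ne := by
    rintro (h | ⟨h, hh⟩)
    · by_cases hh : h ∈ T
      · simp [hh, M.opp_ne]
      · simp [hh]
    · simp
  root := Sum.inr ⟨M.root, hr⟩
  opening := {x | ∃ h, x = Sum.inr h ∧ h.1 ∈ O}
  pairs := {p | ∃ h k, p = (Sum.inr h, Sum.inr k) ∧ k.1 = M.opp h.1 ∧ h.1 ∈ O}
  marked := {p | ∃ h k, p = (Sum.inr h, Sum.inr k) ∧ k.1 = M.opp h.1 ∧ h.1 ∈ M.marked}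

/-- The tree data `t` is, up to isomorphism, what one obtains from `M`, with orientation `O` and
spanning tree `T`, by cutting all the edges that are not in `T`. -/
def MarkedMap.CutsInto (M : MarkedMap) (O T : Set M.H) (t : BlossomData) : Prop :=
  ∃ (hT : ∀ h, M.opp h ∈ T ↔ h ∈ T) (hr : M.root ∉ T), (M.cut O T hT hr).Isomorphic t

/-! For a canonical pair, `O` and `T` determine each other along the clockwise walk, and cutting the
non-tree edges translates each defining condition of the pair into a condition on blossoming trees.
The proof therefore has three ingredients: uniqueness of the pair, its existence, and the inverse
operation of gluing matched leaves.

The geometric input is `reaches_iff_firstTime`: the walk around a tree visits the half-edges at the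
descendants of a vertex during one interval of time, which starts just after the half-edge pointing
down to that vertex and ends with its parent half-edge.

Uniqueness. All orientations with the same outdegrees have equally many edges leaving a given vertex
set (`ncard_exits`). Let W be the descendants of a vertex with parent half-edge `p`. If a second
orientation agrees with `O` on the unmarked external half-edges visited before W is entered, then
every edge it directs out of W is also directed out of W by `O`; by the count the two sets are
equal, and `p` is in both (`mem_of_agree`). With this, two canonical pairs are shown to agree at
each step of their walks, by induction on time (`agree`).

Existence. Consider all pairs of a compatible orientation and an unmarked spanning tree directed by
it to the root vertex. Write down the statuses of the half-edges along the walk, with ingoing < tree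
< outgoing, and take the lexicographically largest word. If some external unmarked edge were visited
first by its ingoing half, then exchanging a tree edge, reversing a loop, or reversing a cycle and
exchanging a tree edge would give a larger word (`improve`).

Cutting and gluing. The cut map is a plane tree exactly when `T` is a spanning tree, and its walk
meets the new leaves in the order in which the walk around `T` meets the external half-edges. Each
vertex has exactly one outgoing half-edge not counted among its non-root opening leaves: its parent
half-edge, or the root half-edge at the root vertex. Hence outdegree k means k - 1 such leaves.
Conversely, gluing the pairs of a marked Eulerian tree gives a map whose inner edges, directed to
the root vertex, form a canonical pair (`exists_closed`). Since an Eulerian map has no leaves,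
isomorphic cut trees come from isomorphic maps. -/

section Time

/-! ### Times of first visit along an orbit -/

variable {X : Type}

/-- The first time at which the sequence `r, f r, f (f r), ...` meets `x`. -/
noncomputable def firstTime (f : X → X) (r x : X) : ℕ := sInf {n | f^[n] r = x}

variable {f : X → X} {r x y : X}

theorem iterate_firstTime (hx : ∃ n, f^[n] r = x) : f^[firstTime f r x] r = x :=
  Nat.sInf_mem (s := {n | f^[n] r = x}) hx

theorem firstTime_le {n : ℕ} (h : f^[n] r = x) : firstTime f r x ≤ n :=
  Nat.sInf_le (s := {n | f^[n] r = x}) h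

theorem firstTime_self : firstTime f r r = 0 := Nat.le_zero.1 (firstTime_le rfl)

/-- An earlier occurrence of the same element would make the orbit reach `x` earlier, so nothing is
repeated before the first visit to `x`. -/
theorem firstTime_iterate {n : ℕ} (hx : ∃ n, f^[n] r = x) (hn : n ≤ firstTime f r x) :
    firstTime f r (f^[n] r) = n := by
  have h1 : f^[firstTime f r (f^[n] r)] r = f^[n] r := iterate_firstTime ⟨n, rfl⟩
  have h2 : firstTime f r (f^[n] r) ≤ n := firstTime_le rfl
  by_contra hne
  have h3 : f^[firstTime f r x - n + firstTime f r (f^[n] r)] r = x := by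
    rw [Function.iterate_add_apply, h1, ← Function.iterate_add_apply, Nat.sub_add_cancel hn,
      iterate_firstTime hx]
  have := firstTime_le h3
  omega

theorem firstTime_injective (hx : ∃ n, f^[n] r = x) (hy : ∃ n, f^[n] r = y)
    (h : firstTime f r x = firstTime f r y) : x = y := by
  rw [← iterate_firstTime hx, h, iterate_firstTime hy]

theorem visitedBefore_iff (hx : ∃ n, f^[n] r = x) (hy : ∃ n, f^[n] r = y) :
    VisitedBefore f r x y ↔ firstTime f r x < firstTime f r y := by
  constructor
  · rintro ⟨n, hn, hm⟩
    refine (firstTime_le hn).trans_lt ?_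
    by_contra hlt
    exact hm _ (not_lt.1 hlt) (iterate_firstTime hy)
  · intro h
    refine ⟨_, iterate_firstTime hx, fun m hm he => ?_⟩
    have := firstTime_le he
    omega

theorem VisitedBefore.asymm (h : VisitedBefore f r x y) : ¬ VisitedBefore f r y x := by
  rintro ⟨m, hm, hm'⟩
  obtain ⟨n, hn, hn'⟩ := h
  rcases le_total m n with h | h
  · exact hn' m h hm
  · exact hm' n h hn

theorem VisitedBefore.map {Y : Type} {g : Y → Y} {e : X ≃ Y} (he : ∀ x, e (f x) = g (e x)) :
    VisitedBefore g (e r) (e x) (e y) ↔ VisitedBefore f r x y := by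
  have : ∀ n z, g^[n] (e z) = e (f^[n] z) := fun n z =>
    ((Function.Semiconj.iterate_right (f := e) (fun z => he z) n) z).symm
  simp [VisitedBefore, this]

/-- A sequence that goes from outside `W` to inside `W` crosses the boundary. -/
theorem exists_crossing {W : Set X} {s : ℕ → X} {a b : ℕ} (hab : a ≤ b) (ha : s a ∉ W)
    (hb : s b ∈ W) : ∃ m, a ≤ m ∧ m < b ∧ s m ∉ W ∧ s (m + 1) ∈ W := by
  induction b, hab using Nat.le_induction with
  | base => exact absurd hb ha
  | succ b hab ih =>
    by_cases h : s b ∈ W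
    · obtain ⟨m, h1, h2, h3⟩ := ih h
      exact ⟨m, h1, by omega, h3⟩
    · exact ⟨b, hab, by omega, h, hb⟩

/-- If the orbit of `r` enters `W` only by `q` and leaves it only by `p`, then it visits `W` during
an interval of time. -/
theorem mem_iff_firstTime {W : Set X} {p q : X} (hf : ∀ x, ∃ n, f^[n] r = x) (hr : r ∉ W)
    (hp : p ∈ W) (hfq : f q ∈ W) (hfp : f p ∉ W)
    (henter : ∀ h, h ∉ W → f h ∈ W → h = q) (hleave : ∀ h, h ∈ W → f h ∉ W → h = p) (h : X) :
    h ∈ W ↔ firstTime f r q < firstTime f r h ∧ firstTime f r h ≤ firstTime f r p := by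
  have enter : ∀ a k, k ∈ W → a ≤ firstTime f r k → f^[a] r ∉ W →
      ∃ m, a ≤ m ∧ m < firstTime f r k ∧ firstTime f r q = m := by
    intro a k hk hak ha
    -- The crossing happens at `q`, before the first visit to `k`; as nothing is repeated until
    -- then, it is the first visit to `q`.
    obtain ⟨m, h1, h2, h3, h4⟩ := exists_crossing (s := fun n => f^[n] r) hak ha
      (by simpa [iterate_firstTime (hf k)] using hk)
    have := henter _ h3 (by simpa [Function.iterate_succ_apply'] using h4)
    exact ⟨m, h1, h2, by rw [← this, firstTime_iterate (hf k) h2.le]⟩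
  have hlt : ∀ k ∈ W, firstTime f r q < firstTime f r k := by
    intro k hk
    obtain ⟨m, -, h2, h3⟩ := enter 0 k hk (Nat.zero_le _) hr
    omega
  have step : ∀ k, f^[firstTime f r k + 1] r = f k := fun k => by
    rw [Function.iterate_succ_apply', iterate_firstTime (hf k)]
  constructor
  · intro hW
    refine ⟨hlt h hW, ?_⟩
    by_contra hc
    -- A first visit later than that of `p` would require entering again after leaving by `p`, which
    -- puts the first visit to `q` after that to `p`.
    obtain ⟨m, h1, h2, h3⟩ := enter (firstTime f r p + 1) h hW (by omega) (by rwa [step])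
    have := hlt p hp
    omega
  · rintro ⟨h1, h2⟩
    by_contra hW
    obtain ⟨m, h3, h4, h5, h6⟩ := exists_crossing (W := Wᶜ) (s := fun n => f^[n] r)
      (a := firstTime f r q + 1) (b := firstTime f r h) (by omega) (by simpa [step] using hfq)
      (by simpa [iterate_firstTime (hf h)] using hW)
    have := hleave _ (by simpa using h5) (by simpa [Function.iterate_succ_apply'] using h6)
    have := firstTime_le this
    omega

end Time

/-! ### Vertices, paths and invariance under isomorphism -/

namespace HalfEdgeMap

instance (M : HalfEdgeMap) : Finite M.H := M.finite

instance (M : HalfEdgeMap) : Finite M.Vertex := by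
  unfold Vertex
  infer_instance

variable {M N : HalfEdgeMap}

theorem vert_eq_iff {h k : M.H} : M.vert h = M.vert k ↔ M.σ.SameCycle h k := Quotient.eq

theorem vert_surjective (M : HalfEdgeMap) : Function.Surjective M.vert := Quotient.mk_surjective

@[simp] theorem vert_σ (h : M.H) : M.vert (M.σ h) = M.vert h :=
  vert_eq_iff.2 (Equiv.Perm.sameCycle_apply_left.2 (Equiv.Perm.SameCycle.refl _ _))

theorem opp_involutive (M : HalfEdgeMap) : Function.Involutive M.opp := M.opp_opp

theorem opp_injective (M : HalfEdgeMap) : Function.Injective M.opp := M.opp_involutive.injective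

theorem IsOrientation.opp_notMem {O : Set M.H} (hO : M.IsOrientation O) {h : M.H} :
    M.opp h ∉ O ↔ h ∈ O := by rw [hO h, not_not]

theorem vert_walk_of_mem {T : Set M.H} {h : M.H} (hh : h ∈ T) :
    M.vert (M.walk T h) = M.vert (M.opp h) := by simp [walk, hh]

theorem vert_walk_of_notMem {T : Set M.H} {h : M.H} (hh : h ∉ T) :
    M.vert (M.walk T h) = M.vert h := by simp [walk, hh]

theorem Reaches.head {S : Set M.H} {h : M.H} (hh : h ∈ S) {v : M.Vertex}
    (hv : M.Reaches S (M.vert (M.opp h)) v) : M.Reaches S (M.vert h) v :=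
  Relation.ReflTransGen.head ⟨h, hh, rfl, rfl⟩ hv

theorem Reaches.single {S : Set M.H} {h : M.H} (hh : h ∈ S) :
    M.Reaches S (M.vert h) (M.vert (M.opp h)) :=
  Relation.ReflTransGen.single ⟨h, hh, rfl, rfl⟩

/-- Paths can be transported along maps of vertices that send edges to paths. -/
theorem Reaches.lift {S : Set M.H} {S' : Set N.H} (φ : M.Vertex → N.Vertex)
    (hφ : ∀ h ∈ S, N.Reaches S' (φ (M.vert h)) (φ (M.vert (M.opp h)))) {u v : M.Vertex}
    (h : M.Reaches S u v) : N.Reaches S' (φ u) (φ v) := by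
  induction h with
  | refl => exact .refl
  | tail _ hs ih =>
    obtain ⟨k, hk, rfl, rfl⟩ := hs
    exact ih.trans (hφ k hk)

theorem Reaches.mono {S S' : Set M.H} (hS : S ⊆ S') {u v : M.Vertex} (h : M.Reaches S u v) :
    M.Reaches S' u v :=
  h.lift id fun _ hk => .single (hS hk)

theorem Reaches.symm {S : Set M.H} (hS : ∀ h, M.opp h ∈ S ↔ h ∈ S) {u v : M.Vertex}
    (h : M.Reaches S u v) : M.Reaches S v u := by
  induction h with
  | refl => exact .refl
  | tail _ hs ih =>
    obtain ⟨k, hk, rfl, rfl⟩ := hs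
    have := Reaches.single ((hS k).2 hk)
    rw [M.opp_opp] at this
    exact Relation.ReflTransGen.trans this ih

namespace IsIso

variable {e : M.H ≃ N.H} (he : IsIso M N e)
include he

theorem sameCycle_iff {h k : M.H} : N.σ.SameCycle (e h) (e k) ↔ M.σ.SameCycle h k := by
  have : N.σ = e.symm.trans (M.σ.trans e) := by
    ext x
    simp [he.map_σ]
  have h2 : ∀ n : ℤ, (N.σ ^ n) (e h) = e ((M.σ ^ n) h) := by
    have : N.σ = e.permCongr M.σ := this
    intro n
    rw [this, ← Equiv.permCongrHom_coe, ← map_zpow]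
    simp
  simp [Equiv.Perm.SameCycle, h2]

end IsIso

/-- The bijection between vertices induced by an isomorphism. -/
def IsIso.vertexEquiv {e : M.H ≃ N.H} (he : IsIso M N e) : M.Vertex ≃ N.Vertex :=
  Quotient.congr e fun _ _ => he.sameCycle_iff.symm

namespace IsIso

variable {e : M.H ≃ N.H}

@[simp] theorem vertexEquiv_vert (he : IsIso M N e) (h : M.H) :
    he.vertexEquiv (M.vert h) = N.vert (e h) := rfl

@[simp] theorem vertexEquiv_rootVertex (he : IsIso M N e) :
    he.vertexEquiv M.rootVertex = N.rootVertex := by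
  simp [rootVertex, he.map_root]

theorem ncard_vertexEquiv (he : IsIso M N e) {S : Set M.H} {S' : Set N.H}
    (hS : ∀ h, e h ∈ S' ↔ h ∈ S) (v : M.Vertex) :
    {h | h ∈ S' ∧ N.vert h = he.vertexEquiv v}.ncard = {h | h ∈ S ∧ M.vert h = v}.ncard := by
  rw [← Set.ncard_image_of_injective _ e.injective]
  congr 1
  ext x
  obtain ⟨h, rfl⟩ := e.surjective x
  obtain ⟨k, rfl⟩ := M.vert_surjective v
  have : N.vert (e h) = N.vert (e k) ↔ M.vert h = M.vert k := by
    rw [← he.vertexEquiv_vert, ← he.vertexEquiv_vert, he.vertexEquiv.apply_eq_iff_eq]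
  simp [hS, this]

theorem degree_vertexEquiv (he : IsIso M N e) (v : M.Vertex) :
    N.degree (he.vertexEquiv v) = M.degree v := by
  simpa [degree] using he.ncard_vertexEquiv (S := Set.univ) (S' := Set.univ) (by simp) v

theorem isLeaf_iff (he : IsIso M N e) (h : M.H) : N.IsLeaf (e h) ↔ M.IsLeaf h := by
  rw [IsLeaf, IsLeaf, ← he.vertexEquiv_vert, he.degree_vertexEquiv]

theorem nodeCount_eq (he : IsIso M N e) (d : ℕ) : N.nodeCount d = M.nodeCount d := by
  refine (Nat.card_congr (he.vertexEquiv.subtypeEquiv fun v => ?_)).symm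
  simp [IsNode, he.degree_vertexEquiv]

theorem reaches (he : IsIso M N e) {S : Set M.H} {S' : Set N.H} (hS : ∀ h, e h ∈ S' ↔ h ∈ S)
    {u v : M.Vertex} (h : M.Reaches S u v) :
    N.Reaches S' (he.vertexEquiv u) (he.vertexEquiv v) := by
  refine h.lift _ fun k hk => Relation.ReflTransGen.single ⟨e k, (hS k).2 hk, rfl, ?_⟩
  rw [he.vertexEquiv_vert, he.map_opp]

theorem isSpanningTree (he : IsIso M N e) {T : Set M.H} {T' : Set N.H}
    (hT : ∀ h, e h ∈ T' ↔ h ∈ T) (h : M.IsSpanningTree T) : N.IsSpanningTree T' where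
  opp_mem_iff x := by
    obtain ⟨x, rfl⟩ := e.surjective x
    rw [← he.map_opp, hT, hT, h.opp_mem_iff]
  connects u v := by
    obtain ⟨u, rfl⟩ := he.vertexEquiv.surjective u
    obtain ⟨v, rfl⟩ := he.vertexEquiv.surjective v
    exact he.reaches hT (h.connects u v)
  card_eq := by
    rw [← Nat.card_congr he.vertexEquiv, ← h.card_eq, ← Set.ncard_image_of_injective T e.injective]
    congr 2
    ext x
    obtain ⟨x, rfl⟩ := e.surjective x
    simp [hT]

theorem map_walk (he : IsIso M N e) {T : Set M.H} {T' : Set N.H}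
    (hT : ∀ h, e h ∈ T' ↔ h ∈ T) (h : M.H) : e (M.walk T h) = N.walk T' (e h) := by
  by_cases hh : h ∈ T <;> simp [walk, hT, hh, he.map_σ, he.map_opp]

theorem visitedBefore_walk_iff (he : IsIso M N e) {T : Set M.H} {T' : Set N.H}
    (hT : ∀ h, e h ∈ T' ↔ h ∈ T) (h k : M.H) :
    VisitedBefore (N.walk T') N.root (e h) (e k) ↔ VisitedBefore (M.walk T) M.root h k := by
  rw [← he.map_root, VisitedBefore.map (he.map_walk hT)]

end IsIso

end HalfEdgeMap

namespace MarkedMap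

theorem IsCanonical.of_isIso {M N : MarkedMap} {e : M.H ≃ N.H}
    (he : HalfEdgeMap.IsIso M.toHalfEdgeMap N.toHalfEdgeMap e)
    (hm : ∀ h, e h ∈ N.marked ↔ h ∈ M.marked)
    {O T : Set M.H} {O' T' : Set N.H} (hO : ∀ h, e h ∈ O' ↔ h ∈ O) (hT : ∀ h, e h ∈ T' ↔ h ∈ T)
    (h : M.IsCanonical M.halfDegree O T) : N.IsCanonical N.halfDegree O' T' := by
  have hmh : ∀ h, e h ∈ N.markedHalfEdges ↔ h ∈ M.markedHalfEdges := fun h => by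
    simp [markedHalfEdges, hm, ← he.map_opp]
  refine ⟨⟨fun x => ?_, fun v => ?_⟩, fun x hx => ?_, he.isSpanningTree hT h.spanning, ?_,
    fun v => ?_, fun x => ?_⟩
  · obtain ⟨x, rfl⟩ := e.surjective x
    rw [← he.map_opp, hO, hO, h.alpha.1]
  · obtain ⟨v, rfl⟩ := he.vertexEquiv.surjective v
    rw [HalfEdgeMap.outDegree, he.ncard_vertexEquiv hO, HalfEdgeMap.halfDegree,
      he.degree_vertexEquiv]
    exact h.alpha.2 v
  · obtain ⟨x, rfl⟩ := e.surjective x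
    exact (hO x).2 (h.compatible ((hm x).1 hx))
  · refine Set.disjoint_left.2 fun x => ?_
    obtain ⟨x, rfl⟩ := e.surjective x
    rw [hT, hmh]
    exact fun h1 => Set.disjoint_left.1 h.unmarked h1
  · obtain ⟨v, rfl⟩ := he.vertexEquiv.surjective v
    rw [← he.vertexEquiv_rootVertex]
    exact he.reaches (fun x => by simp [hO, hT]) (h.internal v)
  · obtain ⟨x, rfl⟩ := e.surjective x
    rw [hT, hmh, hO, ← he.map_opp, he.visitedBefore_walk_iff hT]
    exact h.external x

end MarkedMap

/-! ### Trees directed to the root vertex and the walk around them -/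

namespace HalfEdgeMap

variable {M : HalfEdgeMap}

open Classical in
/-- The walk around a set of edges, as a permutation. -/
noncomputable def walkPerm (M : HalfEdgeMap) (T : Set M.H) (hT : ∀ h, M.opp h ∈ T ↔ h ∈ T) :
    Equiv.Perm M.H :=
  (Function.Involutive.toPerm (fun h => if h ∈ T then M.opp h else h) fun h => by
    by_cases hh : h ∈ T <;> simp [hh, hT, M.opp_opp]).trans M.σ

open Classical in
theorem walkPerm_apply (T : Set M.H) (hT : ∀ h, M.opp h ∈ T ↔ h ∈ T) (h : M.H) :
    M.walkPerm T hT h = M.walk T h := by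
  change M.σ (if h ∈ T then M.opp h else h) = _
  by_cases hh : h ∈ T <;> simp [walk, hh]

/-- `T` is a spanning tree whose edges are directed toward the root vertex by `O`. -/
structure IsRootedTree (M : HalfEdgeMap) (O T : Set M.H) : Prop where
  orientation : M.IsOrientation O
  spanning : M.IsSpanningTree T
  internal : ∀ v, M.Reaches (T ∩ O) v M.rootVertex

/-- If `E` relates every half-edge at a vertex to the next one, with the possible exception of `p`,
then it relates all the half-edges at this vertex. -/
theorem rel_of_vert_eq {E : M.H → M.H → Prop} (hr : ∀ h, E h h)
    (ht : ∀ {a b c}, E a b → E b c → E a c) {p : M.H}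
    (hE : ∀ h, M.vert h = M.vert p → h ≠ p → E h (M.σ h)) {h : M.H} (hh : M.vert h = M.vert p) :
    E h p := by
  obtain ⟨n, hn⟩ := (vert_eq_iff.1 hh).exists_nat_pow_eq
  induction n generalizing h with
  | zero =>
    obtain rfl : h = p := by simpa using hn
    exact hr _
  | succ n ih =>
    by_cases hp : h = p
    · rw [hp]
      exact hr _
    · exact ht (hE h hh hp) (ih (by simpa using hh) (by rwa [pow_succ] at hn))

theorem ncard_tree_inter {O T : Set M.H} (hO : M.IsOrientation O)
    (hT : ∀ h, M.opp h ∈ T ↔ h ∈ T) : T.ncard = 2 * (T ∩ O).ncard := by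
  have : M.opp '' (T ∩ O) = T \ O := by
    ext x
    constructor
    · rintro ⟨y, ⟨h1, h2⟩, rfl⟩
      exact ⟨(hT y).2 h1, hO.opp_notMem.2 h2⟩
    · rintro ⟨h1, h2⟩
      exact ⟨M.opp x, ⟨(hT x).2 h1, (hO x).2 h2⟩, M.opp_opp x⟩
  rw [← Set.ncard_inter_add_ncard_sdiff_eq_ncard T O, ← this,
    Set.ncard_image_of_injective _ M.opp_injective, two_mul]

namespace IsRootedTree

variable {O T : Set M.H} (hT : M.IsRootedTree O T)
include hT

theorem opp_mem (h : M.H) : M.opp h ∈ T ↔ h ∈ T := hT.spanning.opp_mem_iff h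

theorem exists_parent {v : M.Vertex} (hv : v ≠ M.rootVertex) : ∃ h ∈ T ∩ O, M.vert h = v := by
  rcases (hT.internal v).cases_head with h | ⟨w, ⟨k, hk, h1, -⟩, -⟩
  · exact absurd h hv
  · exact ⟨k, hk, h1⟩

/-- Every non-root vertex has a half-edge in `T ∩ O`, and `T ∩ O` is half of `T`, hence one element
fewer than there are vertices. So each non-root vertex has exactly one parent half-edge, and the
root vertex has none. -/
theorem exists_eq_range : ∃ s : {v // v ≠ M.rootVertex} → M.H,
    (∀ v, M.vert (s v) = v.1) ∧ T ∩ O = Set.range s := by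
  choose s hs using fun v : {v // v ≠ M.rootVertex} => hT.exists_parent v.2
  refine ⟨s, fun v => (hs v).2, (Set.eq_of_subset_of_ncard_le ?_ ?_).symm⟩
  · rintro _ ⟨v, rfl⟩
    exact (hs v).1
  · have hinj : Function.Injective s := fun v w h => Subtype.ext (by
      rw [← (hs v).2, h, (hs w).2])
    have h1 := hT.spanning.card_eq
    rw [ncard_tree_inter hT.orientation hT.opp_mem] at h1
    have h2 : (Set.range s).ncard = Nat.card {v // v ≠ M.rootVertex} := by
      rw [← Set.image_univ, Set.ncard_image_of_injective _ hinj, Set.ncard_univ]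
    have h3 := Set.ncard_add_ncard_compl ({M.rootVertex} : Set M.Vertex)
    have h4 : ({M.rootVertex}ᶜ : Set M.Vertex).ncard = Nat.card {v // v ≠ M.rootVertex} := rfl
    rw [Set.ncard_singleton] at h3
    omega

theorem vert_ne_root {h : M.H} (hh : h ∈ T ∩ O) : M.vert h ≠ M.rootVertex := by
  obtain ⟨s, hs, hr⟩ := hT.exists_eq_range
  rw [hr] at hh
  obtain ⟨v, rfl⟩ := hh
  rw [hs]
  exact v.2

theorem eq_of_vert_eq {h k : M.H} (hh : h ∈ T ∩ O) (hk : k ∈ T ∩ O)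
    (hv : M.vert h = M.vert k) : h = k := by
  obtain ⟨s, hs, hr⟩ := hT.exists_eq_range
  rw [hr] at hh hk
  obtain ⟨v, rfl⟩ := hh
  obtain ⟨w, rfl⟩ := hk
  rw [hs, hs] at hv
  rw [Subtype.ext hv]

theorem opp_mem_parent {h : M.H} (hh : h ∈ T) (hn : h ∉ T ∩ O) : M.opp h ∈ T ∩ O :=
  ⟨(hT.opp_mem h).2 hh, (hT.orientation h).2 fun ho => hn ⟨hh, ho⟩⟩

/-- Parent half-edges are unique, so a nontrivial directed path has to start with `h`. -/
theorem reaches_parent {h : M.H} (hh : h ∈ T ∩ O) {c : M.Vertex}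
    (hr : M.Reaches (T ∩ O) (M.vert h) c) (hc : M.vert h ≠ c) :
    M.Reaches (T ∩ O) (M.vert (M.opp h)) c := by
  rcases hr.cases_head with h | ⟨w, ⟨k, hk, h1, h2⟩, h3⟩
  · exact absurd h hc
  · obtain rfl := hT.eq_of_vert_eq hk hh h1
    rwa [h2]

theorem eq_root_of_reaches {v : M.Vertex} (h : M.Reaches (T ∩ O) M.rootVertex v) :
    M.rootVertex = v := by
  rcases h.cases_head with h | ⟨w, ⟨k, hk, h1, -⟩, -⟩
  · exact h
  · exact absurd h1 (hT.vert_ne_root hk)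

/-- The parent of a vertex is not one of its descendants. -/
theorem not_reaches {p : M.H} (hp : p ∈ T ∩ O) :
    ¬ M.Reaches (T ∩ O) (M.vert (M.opp p)) (M.vert p) := by
  intro hc
  have key : ∀ {u v}, M.Reaches (T ∩ O) u v → M.Reaches (T ∩ O) (M.vert p) u →
      M.Reaches (T ∩ O) u (M.vert p) → M.Reaches (T ∩ O) v (M.vert p) := by
    intro u v h
    induction h using Relation.ReflTransGen.head_induction_on with
    | refl => exact fun _ h => h
    | head hs _ ih =>
      obtain ⟨k, hk, rfl, rfl⟩ := hs
      intro h1 h2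
      refine ih (h1.trans (Reaches.single hk)) ?_
      by_cases h : M.vert k = M.vert p
      · rw [hT.eq_of_vert_eq hk hp h]
        exact hc
      · exact hT.reaches_parent hk h2 h
  -- If `p` lay on a directed cycle, the path from its origin to the root vertex could never leave
  -- that cycle, so the root vertex would reach the origin of `p`; but no edge of `T ∩ O` leaves the
  -- root vertex.
  exact hT.vert_ne_root hp (hT.eq_root_of_reaches (key (hT.internal _) .refl .refl)).symm

/-- Induction on the number of descendants. After `M.opp p` the walk continues with `M.σ p` and
turns around the vertex of `p`. It passes across non-tree half-edges; each excursion into a child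
comes back by induction; so it finally arrives at `p`. -/
theorem sameCycle_opp {p : M.H} (hp : p ∈ T ∩ O) :
    (M.walkPerm T hT.opp_mem).SameCycle (M.opp p) p := by
  induction hn : {u | M.Reaches (T ∩ O) u (M.vert p)}.ncard using Nat.strong_induction_on
    generalizing p with
  | _ n ih =>
  subst hn
  have key : ∀ h, M.vert h = M.vert p → h ≠ p →
      (M.walkPerm T hT.opp_mem).SameCycle h (M.σ h) := by
    intro h hv hne
    by_cases hh : h ∈ T
    · have hk := hT.opp_mem_parent hh fun hn => hne (hT.eq_of_vert_eq hn hp hv)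
      have hk' : M.vert (M.opp (M.opp h)) = M.vert p := by rw [M.opp_opp, hv]
      have := ih _ ?_ hk rfl
      · rw [M.opp_opp] at this
        have hw : M.walkPerm T hT.opp_mem (M.opp h) = M.σ h := by
          rw [walkPerm_apply, walk, if_pos ((hT.opp_mem h).2 hh), M.opp_opp]
        rw [← hw]
        exact Equiv.Perm.sameCycle_apply_right.2 this
      · refine Set.ncard_lt_ncard ⟨fun u hu => ?_, fun hs => ?_⟩
        · rw [Set.mem_ofPred_eq, ← hk']
          exact Relation.ReflTransGen.trans hu (Reaches.single hk)
        · refine hT.not_reaches hk ?_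
          rw [hk']
          exact hs (Relation.ReflTransGen.refl)
    · have hw : M.walkPerm T hT.opp_mem h = M.σ h := by
        rw [walkPerm_apply, walk, if_neg hh]
      rw [← hw]
      exact Equiv.Perm.sameCycle_apply_right.2 (.refl _ _)
  have hw : M.walkPerm T hT.opp_mem (M.opp p) = M.σ p := by
    rw [walkPerm_apply, walk, if_pos ((hT.opp_mem p).2 hp.1), M.opp_opp]
  have := rel_of_vert_eq (E := (M.walkPerm T hT.opp_mem).SameCycle) (fun h => .refl _ _)
    (fun h1 h2 => h1.trans h2) key (vert_σ p)
  rw [← hw] at this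
  exact Equiv.Perm.sameCycle_apply_left.1 this

theorem sameCycle_of_vert_eq {h p : M.H} (hp : p ∈ T ∩ O ∨ M.vert p = M.rootVertex)
    (hv : M.vert h = M.vert p) : (M.walkPerm T hT.opp_mem).SameCycle h p := by
  refine rel_of_vert_eq (E := (M.walkPerm T hT.opp_mem).SameCycle) (fun h => .refl _ _)
    (fun h1 h2 => h1.trans h2) (fun k hk hne => ?_) hv
  have hn : k ∉ T ∩ O := by
    rintro hk'
    rcases hp with hp | hp
    · exact hne (hT.eq_of_vert_eq hk' hp hk)
    · exact hT.vert_ne_root hk' (hk.trans hp)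
  by_cases hh : k ∈ T
  · have := hT.sameCycle_opp (hT.opp_mem_parent hh hn)
    rw [M.opp_opp] at this
    have hw : M.walkPerm T hT.opp_mem (M.opp k) = M.σ k := by
      rw [walkPerm_apply, walk, if_pos ((hT.opp_mem k).2 hh), M.opp_opp]
    rw [← hw]
    exact Equiv.Perm.sameCycle_apply_right.2 this
  · have hw : M.walkPerm T hT.opp_mem k = M.σ k := by
      rw [walkPerm_apply, walk, if_neg hh]
    rw [← hw]
    exact Equiv.Perm.sameCycle_apply_right.2 (.refl _ _)

/-- The walk around a spanning tree that starts at the root visits all half-edges. -/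
theorem exists_iterate (h : M.H) : ∃ n, (M.walk T)^[n] M.root = h := by
  suffices H : (M.walkPerm T hT.opp_mem).SameCycle M.root h by
    obtain ⟨n, hn⟩ := H.exists_nat_pow_eq
    refine ⟨n, ?_⟩
    rw [Equiv.Perm.coe_pow] at hn
    rw [← hn]
    congr 2
    ext x
    rw [walkPerm_apply]
  have key : ∀ {v}, M.Reaches (T ∩ O) v M.rootVertex → ∀ h, M.vert h = v →
      (M.walkPerm T hT.opp_mem).SameCycle M.root h := by
    intro v hv
    induction hv using Relation.ReflTransGen.head_induction_on with
    | refl => exact fun h hh => (hT.sameCycle_of_vert_eq (.inr rfl) hh).symm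
    | head hs _ ih =>
      obtain ⟨k, hk, rfl, rfl⟩ := hs
      intro h hh
      exact ((ih _ rfl).trans (hT.sameCycle_opp hk)).trans
        (hT.sameCycle_of_vert_eq (.inl hk) hh).symm
  exact key (hT.internal _) h rfl

/-- The walk around a tree visits the descendants of a vertex during an interval of time. -/
theorem reaches_iff_firstTime {p : M.H} (hp : p ∈ T ∩ O) (h : M.H) :
    M.Reaches (T ∩ O) (M.vert h) (M.vert p) ↔
      firstTime (M.walk T) M.root (M.opp p) < firstTime (M.walk T) M.root h ∧
      firstTime (M.walk T) M.root h ≤ firstTime (M.walk T) M.root p := by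
  -- Vertices change along the walk only through tree edges, and the edge of `p` is the only tree
  -- edge between the descendants and the other vertices.
  refine mem_iff_firstTime (W := {h | M.Reaches (T ∩ O) (M.vert h) (M.vert p)})
    hT.exists_iterate ?_ Relation.ReflTransGen.refl ?_ ?_ ?_ ?_ h
  · intro hr
    exact hT.vert_ne_root hp (hT.eq_root_of_reaches hr).symm
  · rw [Set.mem_ofPred_eq, vert_walk_of_mem ((hT.opp_mem p).2 hp.1), M.opp_opp]
    exact .refl
  · rw [Set.mem_ofPred_eq, vert_walk_of_mem hp.1]
    exact hT.not_reaches hp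
  · intro k hk hw
    rw [Set.mem_ofPred_eq] at hk hw
    by_cases hkT : k ∈ T
    · rw [vert_walk_of_mem hkT] at hw
      have hk' := hT.opp_mem_parent hkT fun hP => hk (hw.head hP)
      by_cases hv : M.vert (M.opp k) = M.vert p
      · rw [← hT.eq_of_vert_eq hk' hp hv, M.opp_opp]
      · have := hT.reaches_parent hk' hw hv
        rw [M.opp_opp] at this
        exact absurd this hk
    · rw [vert_walk_of_notMem hkT] at hw
      exact absurd hw hk
  · intro k hk hw
    rw [Set.mem_ofPred_eq] at hk hw
    by_cases hkT : k ∈ T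
    · rw [vert_walk_of_mem hkT] at hw
      by_cases hP : k ∈ T ∩ O
      · by_cases hv : M.vert k = M.vert p
        · exact hT.eq_of_vert_eq hP hp hv
        · exact absurd (hT.reaches_parent hP hk hv) hw
      · have := hT.opp_mem_parent hkT hP
        refine absurd (Reaches.head this ?_) hw
        rwa [M.opp_opp]
    · rw [vert_walk_of_notMem hkT] at hw
      exact absurd hk hw

end IsRootedTree

end HalfEdgeMap

/-! ### Edge cuts and uniqueness of the canonical pair -/

namespace HalfEdgeMap

variable {M : HalfEdgeMap}

theorem ncard_vert_mem {O O' : Set M.H} (h : ∀ v, M.outDegree O v = M.outDegree O' v)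
    (W : Set M.Vertex) :
    {h | h ∈ O ∧ M.vert h ∈ W}.ncard = {h | h ∈ O' ∧ M.vert h ∈ W}.ncard := by
  classical
  have := Fintype.ofFinite M.H
  have := Fintype.ofFinite M.Vertex
  have key : ∀ O : Set M.H, {h | h ∈ O ∧ M.vert h ∈ W}.ncard =
      ∑ v ∈ Finset.univ.filter (· ∈ W), M.outDegree O v := by
    intro O
    rw [Set.ncard_eq_toFinset_card', Finset.card_eq_sum_card_fiberwise (f := M.vert)
      (t := Finset.univ.filter (· ∈ W))]
    · refine Finset.sum_congr rfl fun v hv => ?_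
      rw [outDegree, Set.ncard_eq_toFinset_card']
      congr 1
      ext x
      have := (Finset.mem_filter.1 hv).2
      simp only [Finset.mem_filter, Set.mem_toFinset, Set.mem_ofPred_eq]
      constructor
      · rintro ⟨⟨h1, h2⟩, h3⟩
        exact ⟨h1, h3⟩
      · rintro ⟨h1, rfl⟩
        exact ⟨⟨h1, this⟩, rfl⟩
    · intro x hx
      simpa using (by simpa using hx : x ∈ O ∧ M.vert x ∈ W).2
  rw [key, key]
  exact Finset.sum_congr rfl fun v _ => h v

/-- The outgoing half-edges through which one leaves a set of vertices. -/
def exits (M : HalfEdgeMap) (O : Set M.H) (W : Set M.Vertex) : Set M.H :=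
  {h | h ∈ O ∧ M.vert h ∈ W ∧ M.vert (M.opp h) ∉ W}

/-- The outdegrees in `W` have a prescribed sum, and the edges inside `W` contribute one each
whatever their direction; the rest counts the exits. -/
theorem ncard_exits {α : M.Vertex → ℕ} {O O' : Set M.H} (hO : M.IsAlphaOrientation α O)
    (hO' : M.IsAlphaOrientation α O') (W : Set M.Vertex) :
    (M.exits O W).ncard = (M.exits O' W).ncard := by
  have h1 := ncard_vert_mem (fun v => (hO.2 v).trans (hO'.2 v).symm) W
  set I : Set M.H := {h | M.vert h ∈ W ∧ M.vert (M.opp h) ∈ W} with hI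
  have hIo : ∀ h, M.opp h ∈ I ↔ h ∈ I := fun h => by simp [hI, M.opp_opp, and_comm]
  have key : ∀ O : Set M.H, {h | h ∈ O ∧ M.vert h ∈ W}.ncard =
      (I ∩ O).ncard + (M.exits O W).ncard := by
    intro O
    rw [← Set.ncard_union_eq]
    · congr 1
      ext x
      simp only [exits, hI, Set.mem_ofPred_eq, Set.mem_union, Set.mem_inter_iff]
      tauto
    · refine Set.disjoint_left.2 ?_
      rintro x ⟨h, -⟩ h'
      exact h'.2.2 h.2
  rw [key, key] at h1
  have h2 := ncard_tree_inter hO.1 hIo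
  have h3 := ncard_tree_inter hO'.1 hIo
  omega

theorem exits_eq_of_subset {α : M.Vertex → ℕ} {O O' : Set M.H} (hO : M.IsAlphaOrientation α O)
    (hO' : M.IsAlphaOrientation α O') {W : Set M.Vertex} (h : M.exits O W ⊆ M.exits O' W) :
    M.exits O W = M.exits O' W :=
  Set.eq_of_subset_of_ncard_le h (ncard_exits hO' hO W).le

/-- A step of the walk depends on the tree only through the membership of the current half-edge, so
the walks cannot separate before the trees disagree on a visited half-edge. -/
theorem iterate_walk_congr {T T' : Set M.H} {n : ℕ}
    (h : ∀ m < n, ((M.walk T)^[m] M.root ∈ T ↔ (M.walk T)^[m] M.root ∈ T')) :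
    (M.walk T')^[n] M.root = (M.walk T)^[n] M.root := by
  induction n with
  | zero => rfl
  | succ n ih =>
    rw [Function.iterate_succ_apply', Function.iterate_succ_apply', ih fun m hm => h m (by omega)]
    have hn := h n (by omega)
    generalize (M.walk T)^[n] M.root = k at hn ⊢
    by_cases hh : k ∈ T
    · rw [walk, walk, if_pos hh, if_pos (hn.1 hh)]
    · rw [walk, walk, if_neg hh, if_neg (hn.not.1 hh)]

end HalfEdgeMap

namespace MarkedMap

variable {M : MarkedMap} {α : M.Vertex → ℕ} {O O' T T' : Set M.H}

theorem mem_marked_of_compatible (hO : M.IsOrientation O) (hc : M.IsCompatible O) {h : M.H}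
    (hh : h ∈ M.markedHalfEdges) : h ∈ O ↔ h ∈ M.marked := by
  refine ⟨fun h1 => hh.resolve_right fun h2 => ?_, fun h1 => hc h1⟩
  exact (hO h).1 (hc h2) h1

theorem IsCanonical.isRootedTree (h : M.IsCanonical α O T) : M.IsRootedTree O T :=
  ⟨h.alpha.1, h.spanning, h.internal⟩

theorem opp_mem_markedHalfEdges {h : M.H} :
    M.opp h ∈ M.markedHalfEdges ↔ h ∈ M.markedHalfEdges := by
  simp [markedHalfEdges, M.opp_opp, or_comm]

/-- If an orientation agrees with the canonical one on all the edges visited before an edge of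
the canonical tree, then it directs this edge toward the root vertex. -/
theorem IsCanonical.mem_of_agree (h : M.IsCanonical α O T) (hO' : M.IsAlphaOrientation α O')
    (hc : M.IsCompatible O') {p : M.H} (hp : p ∈ T ∩ O)
    (hagree : ∀ k, firstTime (M.walk T) M.root k < firstTime (M.walk T) M.root (M.opp p) →
      (k ∉ T) → k ∉ M.markedHalfEdges → (k ∈ O ↔ k ∈ O')) : p ∈ O' := by
  have hT := h.isRootedTree
  set W : Set M.Vertex := {u | M.Reaches (T ∩ O) u (M.vert p)} with hW
  have hpW : M.vert p ∈ W := Relation.ReflTransGen.refl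
  have hqW : M.vert (M.opp p) ∉ W := hT.not_reaches hp
  -- Marked edges have a fixed direction, and a tree edge directed into `W` starts at a descendant,
  -- so it does not cross the boundary. For another edge, the half outside `W` is visited either
  -- before `M.opp p`, where the orientations agree, or after the whole interval of `W`; in the
  -- latter case the half in `W` comes first, hence is outgoing in `O`.
  have hsub : M.exits O' W ⊆ M.exits O W := by
    rintro k ⟨hk, hk1, hk2⟩
    refine ⟨?_, hk1, hk2⟩
    by_cases hm : k ∈ M.markedHalfEdges
    · rwa [mem_marked_of_compatible h.alpha.1 h.compatible hm,
        ← mem_marked_of_compatible hO'.1 hc hm]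
    by_cases hkT : k ∈ T
    · by_contra hkO
      have := hT.opp_mem_parent hkT fun hk => hkO hk.2
      refine hk2 (HalfEdgeMap.Reaches.head this ?_)
      rwa [M.opp_opp]
    · have h1 := (hT.reaches_iff_firstTime hp k).1 hk1
      have h2 := fun h => hk2 ((hT.reaches_iff_firstTime hp (M.opp k)).2 h)
      by_cases h3 : firstTime (M.walk T) M.root (M.opp k) <
          firstTime (M.walk T) M.root (M.opp p)
      · have := hagree _ h3 (by rwa [hT.opp_mem]) (by rwa [opp_mem_markedHalfEdges])
        rw [h.alpha.1, hO'.1] at this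
        tauto
      · have hne : firstTime (M.walk T) M.root (M.opp k) ≠
            firstTime (M.walk T) M.root (M.opp p) := by
          intro he
          have := firstTime_injective (hT.exists_iterate _) (hT.exists_iterate _) he
          rw [M.opp_injective this] at hkT
          exact hkT hp.1
        rw [h.external k hkT hm, visitedBefore_iff (hT.exists_iterate _) (hT.exists_iterate _)]
        by_contra h4
        exact h2 ⟨by omega, by omega⟩
  have := HalfEdgeMap.exits_eq_of_subset hO' h.alpha hsub
  have hpe : p ∈ M.exits O W := ⟨hp.2, hpW, hqW⟩
  rw [← this] at hpe
  exact hpe.1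

/-- If the root half-edge can be directed outward, then it is not in the canonical tree and it is
outgoing in the canonical orientation. -/
theorem IsCanonical.root_mem (h : M.IsCanonical α O T) (hO' : M.IsAlphaOrientation α O')
    (hc : M.IsCompatible O') (hr : M.root ∈ O') : M.root ∉ T ∧ M.root ∈ O := by
  have hT := h.isRootedTree
  have hrT : M.root ∉ T := by
    intro hrT
    have hp := hT.opp_mem_parent hrT fun hp => hT.vert_ne_root hp rfl
    -- Here the half pointing down is the root itself, visited at time 0, so the agreement
    -- hypothesis is vacuous.
    have := h.mem_of_agree hO' hc hp fun k hk => by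
      rw [M.opp_opp, firstTime_self] at hk
      omega
    exact (hO'.1 _).1 this hr
  refine ⟨hrT, ?_⟩
  by_cases hm : M.root ∈ M.markedHalfEdges
  · rw [mem_marked_of_compatible h.alpha.1 h.compatible hm]
    exact (mem_marked_of_compatible hO'.1 hc hm).1 hr
  · rw [h.external _ hrT hm]
    exact ⟨0, rfl, fun m hm => by
      obtain rfl : m = 0 := by omega
      exact (M.opp_ne _).symm⟩

/-- Only a first visit to an edge needs an argument. If the edge is in `T` and visited for the first
time, its current half points down the tree, so `mem_of_agree` forces `O'` to direct the edge
upward. If it were not in `T'`, the external rule would make the current half outgoing in `O'`: a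
contradiction. -/
theorem IsCanonical.agree_step (h : M.IsCanonical α O T) (h' : M.IsCanonical α O' T') {n : ℕ}
    (hw : ∀ m ≤ n, (M.walk T')^[m] M.root = (M.walk T)^[m] M.root)
    (ih : ∀ m < n, ((M.walk T)^[m] M.root ∈ T ↔ (M.walk T)^[m] M.root ∈ T') ∧
      ((M.walk T)^[m] M.root ∈ O ↔ (M.walk T)^[m] M.root ∈ O'))
    (hT : (M.walk T)^[n] M.root ∈ T) : (M.walk T)^[n] M.root ∈ T' := by
  have hR := h.isRootedTree
  have hR' := h'.isRootedTree
  set k := (M.walk T)^[n] M.root with hk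
  have hkn : firstTime (M.walk T) M.root k ≤ n := firstTime_le rfl
  have ih' : ∀ x, firstTime (M.walk T) M.root x < n → (x ∈ T ↔ x ∈ T') ∧ (x ∈ O ↔ x ∈ O') := by
    intro x hx
    have := ih _ hx
    rwa [iterate_firstTime (hR.exists_iterate x)] at this
  by_cases hkn' : firstTime (M.walk T) M.root k < n
  · exact (ih' k hkn').1.1 hT
  by_cases hon : firstTime (M.walk T) M.root (M.opp k) < n
  · have := (ih' _ hon).1
    rw [hR.opp_mem, hR'.opp_mem] at this
    exact this.1 hT
  by_contra hT'
  have hm : k ∉ M.markedHalfEdges := Set.disjoint_left.1 h.unmarked hT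
  have hkO' : k ∈ O' := by
    rw [h'.external k hT' hm]
    refine ⟨n, hw n le_rfl, fun m hmn hmk => hon ?_⟩
    rw [hw m hmn] at hmk
    refine lt_of_le_of_ne ((firstTime_le hmk).trans hmn) fun he => ?_
    have := iterate_firstTime (hR.exists_iterate (M.opp k))
    rw [he] at this
    exact M.opp_ne k this.symm
  by_cases hkO : k ∈ T ∩ O
  · have h1 := (hR.reaches_iff_firstTime hkO k).1 .refl
    omega
  · have := h.mem_of_agree h'.alpha h'.compatible (hR.opp_mem_parent hT hkO) fun x hx _ _ => by
      rw [M.opp_opp] at hx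
      exact (ih' x (by omega)).2
    exact (h'.alpha.1 _).1 this hkO'

/-- For a tree edge, the half pointing toward the root vertex is visited second, so induction
applies to the other half. A marked edge is fixed, and for the remaining edges the rule depends only
on the common part of the walks. -/
theorem IsCanonical.agree_orientation (h : M.IsCanonical α O T) (h' : M.IsCanonical α O' T')
    {n : ℕ} (hw : ∀ m ≤ n, (M.walk T')^[m] M.root = (M.walk T)^[m] M.root)
    (ih : ∀ m < n, ((M.walk T)^[m] M.root ∈ T ↔ (M.walk T)^[m] M.root ∈ T') ∧
      ((M.walk T)^[m] M.root ∈ O ↔ (M.walk T)^[m] M.root ∈ O'))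
    (hT : (M.walk T)^[n] M.root ∈ T ↔ (M.walk T)^[n] M.root ∈ T')
    (hO : (M.walk T)^[n] M.root ∈ O) : (M.walk T)^[n] M.root ∈ O' := by
  have hR := h.isRootedTree
  have hR' := h'.isRootedTree
  set k := (M.walk T)^[n] M.root with hk
  have hkn : firstTime (M.walk T) M.root k ≤ n := firstTime_le rfl
  have ih' : ∀ x, firstTime (M.walk T) M.root x < n → (x ∈ T ↔ x ∈ T') ∧ (x ∈ O ↔ x ∈ O') := by
    intro x hx
    have := ih _ hx
    rwa [iterate_firstTime (hR.exists_iterate x)] at this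
  by_cases hkn' : firstTime (M.walk T) M.root k < n
  · exact (ih' k hkn').2.1 hO
  by_cases hkT : k ∈ T
  · have h1 := (hR.reaches_iff_firstTime ⟨hkT, hO⟩ k).1 .refl
    have h2 := (ih' (M.opp k) (by omega)).2
    rw [h.alpha.1, h'.alpha.1] at h2
    tauto
  by_cases hm : k ∈ M.markedHalfEdges
  · rw [mem_marked_of_compatible h'.alpha.1 h'.compatible hm]
    exact (mem_marked_of_compatible h.alpha.1 h.compatible hm).1 hO
  · obtain ⟨i, hi, hi'⟩ := (h.external k hkT hm).1 hO
    rw [h'.external k (fun h => hkT (hT.2 h)) hm]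
    refine ⟨n, hw n le_rfl, fun m hmn hmk => hi' m ?_ ?_⟩
    · have := firstTime_le hi
      omega
    · rw [← hw m hmn, hmk]

theorem IsCanonical.agree (h : M.IsCanonical α O T) (h' : M.IsCanonical α O' T') (n : ℕ) :
    ((M.walk T)^[n] M.root ∈ T ↔ (M.walk T)^[n] M.root ∈ T') ∧
      ((M.walk T)^[n] M.root ∈ O ↔ (M.walk T)^[n] M.root ∈ O') := by
  induction n using Nat.strong_induction_on with
  | _ n ih =>
  have hw : ∀ m ≤ n, (M.walk T')^[m] M.root = (M.walk T)^[m] M.root := fun m hm =>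
    HalfEdgeMap.iterate_walk_congr fun i hi => (ih i (by omega)).1
  have ih' : ∀ m < n, ((M.walk T')^[m] M.root ∈ T' ↔ (M.walk T')^[m] M.root ∈ T) ∧
      ((M.walk T')^[m] M.root ∈ O' ↔ (M.walk T')^[m] M.root ∈ O) := by
    intro m hm
    rw [hw m hm.le]
    exact ⟨(ih m hm).1.symm, (ih m hm).2.symm⟩
  have hT : (M.walk T)^[n] M.root ∈ T ↔ (M.walk T)^[n] M.root ∈ T' := by
    refine ⟨h.agree_step h' hw ih, fun hk => ?_⟩
    rw [← hw n le_rfl] at hk ⊢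
    exact h'.agree_step h (fun m hm => (hw m hm).symm) ih' hk
  refine ⟨hT, h.agree_orientation h' hw ih hT, fun hk => ?_⟩
  have hw' := hw n le_rfl
  rw [← hw'] at hk hT ⊢
  exact h'.agree_orientation h (fun m hm => (hw m hm).symm) ih' hT.symm hk

theorem IsCanonical.unique (h : M.IsCanonical α O T) (h' : M.IsCanonical α O' T') :
    O = O' ∧ T = T' := by
  constructor <;> ext x <;> obtain ⟨n, rfl⟩ := h.isRootedTree.exists_iterate x
  · exact (h.agree h' n).2
  · exact (h.agree h' n).1

end MarkedMap

/-! ### Building trees, exchanging edges, reversing cycles -/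

namespace HalfEdgeMap

variable {M : HalfEdgeMap}

theorem exists_height {S : Set M.H} (hS : ∀ v, M.Reaches S v M.rootVertex) :
    ∃ d : M.Vertex → ℕ, ∀ v, v ≠ M.rootVertex →
      ∃ h ∈ S, M.vert h = v ∧ d (M.vert (M.opp h)) < d v := by
  -- `R n` consists of the vertices with a path of exactly `n` steps to the root vertex. The height
  -- is the least such `n`, and the first step of a shortest path lowers it.
  let R : ℕ → Set M.Vertex := fun n => Nat.rec {M.rootVertex}
    (fun _ A => {v | ∃ h ∈ S, M.vert h = v ∧ M.vert (M.opp h) ∈ A}) n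
  have hR : ∀ v, ∃ n, v ∈ R n := by
    intro v
    induction hS v using Relation.ReflTransGen.head_induction_on with
    | refl => exact ⟨0, rfl⟩
    | head hs _ ih =>
      obtain ⟨k, hk, rfl, rfl⟩ := hs
      obtain ⟨n, hn⟩ := ih
      exact ⟨n + 1, k, hk, rfl, hn⟩
  refine ⟨fun v => sInf {n | v ∈ R n}, fun v hv => ?_⟩
  have h1 : v ∈ R (sInf {n | v ∈ R n}) := Nat.sInf_mem (s := {n | v ∈ R n}) (hR v)
  obtain h0 | ⟨n, hn⟩ := Nat.eq_zero_or_eq_succ_pred (sInf {n | v ∈ R n}) |>.imp_right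
    fun h => (⟨_, h⟩ : ∃ n, sInf {n | v ∈ R n} = n + 1)
  · rw [h0] at h1
    exact absurd h1 hv
  · rw [hn] at h1
    obtain ⟨h, hh, h2, h3⟩ := h1
    refine ⟨h, hh, h2, ?_⟩
    have : sInf {n | M.vert (M.opp h) ∈ R n} ≤ n :=
      Nat.sInf_le (s := {n | M.vert (M.opp h) ∈ R n}) h3
    simp only
    omega

/-- If all vertices can be joined to the root vertex, they can be joined along a tree. -/
theorem exists_parents {S : Set M.H} (hS : ∀ v, M.Reaches S v M.rootVertex) :
    ∃ P ⊆ S, (∀ h ∈ P, M.opp h ∉ P) ∧ (∀ v, M.Reaches P v M.rootVertex) ∧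
      P.ncard + 1 = Nat.card M.Vertex := by
  obtain ⟨d, hd⟩ := exists_height hS
  choose s hs1 hs2 hs3 using fun v : {v // v ≠ M.rootVertex} => hd v.1 v.2
  have hinj : Function.Injective s := fun v w h => Subtype.ext (by
    rw [← hs2 v, h, hs2 w])
  refine ⟨Set.range s, ?_, ?_, fun v => ?_, ?_⟩
  · rintro _ ⟨v, rfl⟩
    exact hs1 v
  · rintro _ ⟨v, rfl⟩ ⟨w, hw⟩
    have h1 := hs3 v
    have h2 := hs3 w
    rw [← hs2 v] at h1
    rw [← hs2 w, hw, M.opp_opp] at h2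
    omega
  · induction hn : d v using Nat.strong_induction_on generalizing v with
    | _ n ih =>
    by_cases hv : v = M.rootVertex
    · rw [hv]
      exact .refl
    · have h1 := hs3 ⟨v, hv⟩
      have h2 := hs2 ⟨v, hv⟩
      have := ih _ (by simpa [← hn] using h1) _ rfl
      have := Reaches.head (Set.mem_range_self (f := s) ⟨v, hv⟩) this
      rwa [h2] at this
  · have h2 : (Set.range s).ncard = Nat.card {v // v ≠ M.rootVertex} := by
      rw [← Set.image_univ, Set.ncard_image_of_injective _ hinj, Set.ncard_univ]
    have h3 := Set.ncard_add_ncard_compl ({M.rootVertex} : Set M.Vertex)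
    have h4 : ({M.rootVertex}ᶜ : Set M.Vertex).ncard = Nat.card {v // v ≠ M.rootVertex} := rfl
    rw [Set.ncard_singleton] at h3
    omega

/-- The set of the half-edges of the edges with a half in `P`. -/
def edgesOf (M : HalfEdgeMap) (P : Set M.H) : Set M.H := {h | h ∈ P ∨ M.opp h ∈ P}

theorem opp_mem_edgesOf (P : Set M.H) (h : M.H) : M.opp h ∈ M.edgesOf P ↔ h ∈ M.edgesOf P := by
  simp [edgesOf, M.opp_opp, or_comm]

theorem ncard_edgesOf {P : Set M.H} (hP : ∀ h ∈ P, M.opp h ∉ P) :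
    (M.edgesOf P).ncard = 2 * P.ncard := by
  have : M.edgesOf P = P ∪ M.opp '' P := by
    ext x
    simp only [edgesOf, Set.mem_ofPred_eq, Set.mem_union, Set.mem_image]
    refine or_congr_right ⟨fun h => ⟨_, h, M.opp_opp x⟩, ?_⟩
    rintro ⟨y, hy, rfl⟩
    rwa [M.opp_opp]
  rw [this, Set.ncard_union_eq, Set.ncard_image_of_injective _ M.opp_injective, two_mul]
  refine Set.disjoint_left.2 ?_
  rintro _ h ⟨y, hy, rfl⟩
  exact hP y hy h

theorem isSpanningTree_of_reaches {T S : Set M.H} (hT : ∀ h, M.opp h ∈ T ↔ h ∈ T) (hS : S ⊆ T)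
    (hr : ∀ v, M.Reaches S v M.rootVertex) (hc : T.ncard + 2 = 2 * Nat.card M.Vertex) :
    M.IsSpanningTree T :=
  ⟨hT, fun u v => ((hr u).mono hS).trans (((hr v).mono hS).symm hT), hc⟩

theorem isSpanningTree_edgesOf {P : Set M.H} (hP : ∀ h ∈ P, M.opp h ∉ P)
    (hr : ∀ v, M.Reaches P v M.rootVertex) (hc : P.ncard + 1 = Nat.card M.Vertex) :
    M.IsSpanningTree (M.edgesOf P) :=
  isSpanningTree_of_reaches (opp_mem_edgesOf P) (fun _ h => .inl h) hr (by
    rw [ncard_edgesOf hP]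
    omega)

/-- The set of edges obtained from `T` by deleting the edge of `p` and adding the edge of `h`. -/
def exchange (M : HalfEdgeMap) (T : Set M.H) (p h : M.H) : Set M.H :=
  (T \ {p, M.opp p}) ∪ {h, M.opp h}

theorem mem_exchange {T : Set M.H} {p h k : M.H} : k ∈ M.exchange T p h ↔
    (k ∈ T ∧ k ≠ p ∧ k ≠ M.opp p) ∨ k = h ∨ k = M.opp h := by
  simp only [exchange, Set.mem_union, Set.mem_sdiff, Set.mem_insert_iff, Set.mem_singleton_iff,
    not_or, ne_eq]

theorem opp_eq_comm {h k : M.H} : M.opp h = k ↔ h = M.opp k :=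
  ⟨fun e => by rw [← e, M.opp_opp], fun e => by rw [e, M.opp_opp]⟩

theorem opp_mem_exchange {T : Set M.H} (hT : ∀ h, M.opp h ∈ T ↔ h ∈ T) {p h : M.H} (k : M.H) :
    M.opp k ∈ M.exchange T p h ↔ k ∈ M.exchange T p h := by
  rw [mem_exchange, mem_exchange, hT, Ne, Ne, opp_eq_comm, M.opp_injective.eq_iff, opp_eq_comm,
    M.opp_injective.eq_iff]
  tauto

theorem ncard_exchange {T : Set M.H} (hT : ∀ h, M.opp h ∈ T ↔ h ∈ T) {p h : M.H} (hp : p ∈ T)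
    (hh : h ∉ T) : (M.exchange T p h).ncard = T.ncard := by
  have hsub : {p, M.opp p} ⊆ T := by
    rintro x (rfl | rfl)
    · exact hp
    · exact (hT _).2 hp
  have h2 : ∀ x, ({x, M.opp x} : Set M.H).ncard = 2 := fun x => Set.ncard_pair (M.opp_ne x).symm
  have h3 := Set.ncard_le_ncard hsub
  rw [exchange, Set.ncard_union_eq, h2, Set.ncard_sdiff hsub, h2]
  · rw [h2] at h3
    omega
  · refine Set.disjoint_left.2 ?_
    rintro x ⟨hx, -⟩ (rfl | rfl)
    · exact hh hx
    · exact hh ((hT _).1 hx)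

/-- The orientation obtained by reversing the edges with outgoing half in `C`. -/
def flip (M : HalfEdgeMap) (O C : Set M.H) : Set M.H := {k | (k ∈ O ∧ k ∉ C) ∨ M.opp k ∈ C}

/-- `C` enters and leaves each vertex equally often, so reversal does not change outdegrees. This
covers directed cycles, including loops. -/
theorem IsAlphaOrientation.flip {α : M.Vertex → ℕ} {O C : Set M.H}
    (hO : M.IsAlphaOrientation α O) (hC : C ⊆ O)
    (hb : ∀ v, {k | k ∈ C ∧ M.vert k = v}.ncard = {k | k ∈ C ∧ M.vert (M.opp k) = v}.ncard) :
    M.IsAlphaOrientation α (M.flip O C) := by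
  have hCo : ∀ k, k ∈ C → M.opp k ∉ C := fun k hk hk' => (hO.1 k).1 (hC hk') (hC hk)
  refine ⟨fun k => ?_, fun v => ?_⟩
  · have h1 := hO.1 k
    have h2 := hCo k
    have h3 := @hC k
    simp only [HalfEdgeMap.flip, Set.mem_ofPred_eq, M.opp_opp]
    tauto
  · have h1 : {k | k ∈ M.flip O C ∧ M.vert k = v} =
        {k | (k ∈ O ∧ k ∉ C) ∧ M.vert k = v} ∪ {k | M.opp k ∈ C ∧ M.vert k = v} := by
      ext k
      simp only [HalfEdgeMap.flip, Set.mem_ofPred_eq, Set.mem_union]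
      tauto
    have h2 : {k | k ∈ O ∧ M.vert k = v} =
        {k | (k ∈ O ∧ k ∉ C) ∧ M.vert k = v} ∪ {k | k ∈ C ∧ M.vert k = v} := by
      ext k
      have := @hC k
      simp only [Set.mem_ofPred_eq, Set.mem_union]
      tauto
    have h3 : {k | M.opp k ∈ C ∧ M.vert k = v} = M.opp '' {k | k ∈ C ∧ M.vert (M.opp k) = v} := by
      ext k
      constructor
      · rintro ⟨h1, h2⟩
        exact ⟨M.opp k, ⟨h1, by rwa [M.opp_opp]⟩, M.opp_opp k⟩
      · rintro ⟨k, ⟨h1, h2⟩, rfl⟩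
        exact ⟨by rwa [M.opp_opp], h2⟩
    rw [← hO.2 v, outDegree, outDegree, h1, h2, Set.ncard_union_eq, Set.ncard_union_eq, h3,
      Set.ncard_image_of_injective _ M.opp_injective, hb]
    · exact Set.disjoint_left.2 fun k h1 h2 => h1.1.2 h2.1
    · exact Set.disjoint_left.2 fun k h1 h2 => (hO.1 k).1 (hC h2.1) h1.1.1

open Classical in
/-- In the path of a rooted tree that goes from `v` to the origin of `p` and then along `p`, every
vertex other than the ends is entered as many times as it is left. -/
theorem IsRootedTree.path_balance {O T : Set M.H} (hT : M.IsRootedTree O T) {p : M.H}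
    (hp : p ∈ T ∩ O) {v : M.Vertex} (hv : M.Reaches (T ∩ O) v (M.vert p)) (y : M.Vertex) :
    {k | (k ∈ T ∩ O ∧ M.Reaches (T ∩ O) v (M.vert k) ∧ M.Reaches (T ∩ O) (M.vert k) (M.vert p)) ∧
        M.vert k = y}.ncard + (if y = M.vert (M.opp p) then 1 else 0) =
      {k | (k ∈ T ∩ O ∧ M.Reaches (T ∩ O) v (M.vert k) ∧
        M.Reaches (T ∩ O) (M.vert k) (M.vert p)) ∧ M.vert (M.opp k) = y}.ncard +
        (if y = v then 1 else 0) := by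
  -- The path is built by prepending one half-edge at a time; this counts the effect on half-edges
  -- starting, or ending, at `y`.
  have insert_card : ∀ (Q : M.H → Prop) (φ : M.H → M.Vertex) (k : M.H), ¬ Q k →
      {x | (x = k ∨ Q x) ∧ φ x = y}.ncard =
        {x | Q x ∧ φ x = y}.ncard + (if y = φ k then 1 else 0) := by
    intro Q φ k hk
    by_cases hy : y = φ k
    · rw [if_pos hy, ← Set.ncard_insert_of_notMem (a := k)]
      · congr 1
        ext x
        simp only [Set.mem_ofPred_eq, Set.mem_insert_iff]
        constructor
        · rintro ⟨rfl | h, h'⟩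
          · exact .inl rfl
          · exact .inr ⟨h, h'⟩
        · rintro (rfl | ⟨h, h'⟩)
          · exact ⟨.inl rfl, hy.symm⟩
          · exact ⟨.inr h, h'⟩
      · exact fun h => hk h.1
    · rw [if_neg hy]
      congr 1
      ext x
      simp only [Set.mem_ofPred_eq]
      constructor
      · rintro ⟨rfl | h, h'⟩
        · exact absurd h'.symm hy
        · exact ⟨h, h'⟩
      · exact fun h => ⟨.inr h.1, h.2⟩
  induction hv using Relation.ReflTransGen.head_induction_on with
  | refl =>
    have : ∀ k, (k ∈ T ∩ O ∧ M.Reaches (T ∩ O) (M.vert p) (M.vert k) ∧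
        M.Reaches (T ∩ O) (M.vert k) (M.vert p)) ↔ (k = p ∨ False) := by
      intro k
      rw [or_false]
      constructor
      · rintro ⟨h1, h2, h3⟩
        by_contra hne
        have hv : M.vert p ≠ M.vert k := fun h => hne (hT.eq_of_vert_eq h1 hp h.symm)
        exact hT.not_reaches hp ((hT.reaches_parent hp h2 hv).trans h3)
      · rintro rfl
        exact ⟨hp, .refl, .refl⟩
    simp only [this]
    rw [insert_card _ _ _ id, insert_card _ _ _ id]
    simp only [false_and, Set.ofPred_false, Set.ncard_empty]
    omega
  | head hs hr ih =>
    obtain ⟨e, he, rfl, rfl⟩ := hs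
    have : ∀ k, (k ∈ T ∩ O ∧ M.Reaches (T ∩ O) (M.vert e) (M.vert k) ∧
        M.Reaches (T ∩ O) (M.vert k) (M.vert p)) ↔ (k = e ∨ (k ∈ T ∩ O ∧
        M.Reaches (T ∩ O) (M.vert (M.opp e)) (M.vert k) ∧
        M.Reaches (T ∩ O) (M.vert k) (M.vert p))) := by
      intro k
      constructor
      · rintro ⟨h1, h2, h3⟩
        by_cases hv : M.vert e = M.vert k
        · exact .inl (hT.eq_of_vert_eq h1 he hv.symm)
        · exact .inr ⟨h1, hT.reaches_parent he h2 hv, h3⟩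
      · rintro (rfl | ⟨h1, h2, h3⟩)
        · exact ⟨he, .refl, Reaches.head he hr⟩
        · exact ⟨h1, Reaches.head he h2, h3⟩
    simp only [this]
    rw [insert_card _ _ _ (fun h => hT.not_reaches he h.2.1),
      insert_card _ _ _ (fun h => hT.not_reaches he h.2.1)]
    omega

end HalfEdgeMap

/-! ### Existence of the canonical pair by lexicographic maximality -/

namespace HalfEdgeMap

variable {M : HalfEdgeMap} {O T O' T' : Set M.H}

open Classical in
/-- The status of a half-edge with respect to an orientation and a tree. -/
noncomputable def status (M : HalfEdgeMap) (O T : Set M.H) (h : M.H) : ℕ :=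
  -- Only the order ingoing < tree < outgoing matters: at the first change, the three improvements
  -- below raise the status from 0 to 1, from 0 to 2 and from 1 to 2.
  if h ∈ T then 1 else if h ∈ O then 2 else 0

/-- The sequence of the statuses of the half-edges met by the walk around a tree. -/
noncomputable def statusWord (M : HalfEdgeMap) (O T : Set M.H) : Lex (ℕ → ℕ) :=
  toLex fun n => M.status O T ((M.walk T)^[n] M.root)

/-- Agreement before `q` makes both walks coincide up to `q`, so the letters at the first visit to
`q` decide the comparison. -/
theorem IsRootedTree.statusWord_lt (hT : M.IsRootedTree O T) {q : M.H}
    (h : ∀ k, firstTime (M.walk T) M.root k < firstTime (M.walk T) M.root q →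
      (k ∈ T ↔ k ∈ T') ∧ (k ∈ O ↔ k ∈ O')) (hq : M.status O T q < M.status O' T' q) :
    M.statusWord O T < M.statusWord O' T' := by
  have h' : ∀ m < firstTime (M.walk T) M.root q,
      ((M.walk T)^[m] M.root ∈ T ↔ (M.walk T)^[m] M.root ∈ T') ∧
      ((M.walk T)^[m] M.root ∈ O ↔ (M.walk T)^[m] M.root ∈ O') :=
    fun m hm => h _ ((firstTime_le rfl).trans_lt hm)
  have hw : ∀ m ≤ firstTime (M.walk T) M.root q,
      (M.walk T')^[m] M.root = (M.walk T)^[m] M.root :=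
    fun m hm => iterate_walk_congr fun i hi => (h' i (by omega)).1
  refine ⟨firstTime (M.walk T) M.root q, fun m hm => ?_, ?_⟩
  · change M.status O T _ = M.status O' T' _
    rw [hw m hm.le]
    have hm' := h' m hm
    simp only [status]
    split_ifs <;> tauto
  · change M.status O T _ < M.status O' T' _
    rwa [hw _ le_rfl, iterate_firstTime (hT.exists_iterate q)]

end HalfEdgeMap

namespace MarkedMap

open HalfEdgeMap

variable {M : MarkedMap} {α : M.Vertex → ℕ} {O T : Set M.H}

/-- A compatible orientation together with an unmarked spanning tree that it directs toward the
root vertex. -/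
structure IsPrecanonical (M : MarkedMap) (α : M.Vertex → ℕ) (O T : Set M.H) : Prop where
  alpha : M.IsAlphaOrientation α O
  compatible : M.IsCompatible O
  spanning : M.IsSpanningTree T
  unmarked : Disjoint T M.markedHalfEdges
  internal : ∀ v, M.Reaches (T ∩ O) v M.rootVertex

theorem IsPrecanonical.isRootedTree (h : M.IsPrecanonical α O T) : M.IsRootedTree O T :=
  ⟨h.alpha.1, h.spanning, h.internal⟩

theorem exists_isPrecanonical (hO : M.IsAlphaOrientation α O) (hc : M.IsCompatible O)
    (ha : M.IsRootAccessible O) : ∃ T, M.IsPrecanonical α O T := by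
  obtain ⟨P, hPO, hP, hr, hcard⟩ := exists_parents ha
  have hsub : P ⊆ M.edgesOf P ∩ O := fun h hh => ⟨.inl hh, (hPO hh).1⟩
  refine ⟨M.edgesOf P, hO, hc, isSpanningTree_edgesOf hP hr hcard, ?_, fun v =>
    (hr v).mono hsub⟩
  refine Set.disjoint_left.2 ?_
  rintro k (hk | hk)
  · exact (hPO hk).2
  · exact fun h => (hPO hk).2 (opp_mem_markedHalfEdges.2 h)

theorem disjoint_exchange (hT : Disjoint T M.markedHalfEdges) {p h : M.H}
    (hh : h ∉ M.markedHalfEdges) : Disjoint (M.exchange T p h) M.markedHalfEdges := by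
  refine Set.disjoint_left.2 fun k hk => ?_
  rcases mem_exchange.1 hk with hk | rfl | rfl
  · exact Set.disjoint_left.1 hT hk.1
  · exact hh
  · rwa [opp_mem_markedHalfEdges]

theorem isSpanningTree_exchange {S : Set M.H} (hT : M.IsSpanningTree T) {p h : M.H} (hp : p ∈ T)
    (hh : h ∉ T) (hS : S ⊆ M.exchange T p h) (hr : ∀ v, M.Reaches S v M.rootVertex) :
    M.IsSpanningTree (M.exchange T p h) :=
  isSpanningTree_of_reaches (opp_mem_exchange hT.opp_mem_iff) hS hr (by
    rw [ncard_exchange hT.opp_mem_iff hp hh, hT.card_eq])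

variable {h : M.H}

/-- If an edge that is not in the tree is first visited by its ingoing half, and does not start at
an ancestor of its end, then it can replace a tree edge. -/
theorem IsPrecanonical.improve_tree (hT : M.IsPrecanonical α O T) (hh : h ∉ T)
    (hm : h ∉ M.markedHalfEdges) (ho : M.opp h ∈ O)
    (ht : firstTime (M.walk T) M.root h < firstTime (M.walk T) M.root (M.opp h))
    (hv : ¬ M.Reaches (T ∩ O) (M.vert h) (M.vert (M.opp h))) :
    ∃ T', M.IsPrecanonical α O T' ∧ M.statusWord O T < M.statusWord O T' := by
  have hR := hT.isRootedTree
  -- The origin of the edge is not the root vertex, which every vertex reaches. Its parent edge `p`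
  -- is the one to be replaced; as the end of the new edge is not a descendant, no cycle is created.
  obtain ⟨p, hp, hpx⟩ := hR.exists_parent (v := M.vert (M.opp h)) fun h => hv (by
    rw [h]
    exact hR.internal _)
  have hoh : M.opp h ∈ M.exchange T p h ∩ O := ⟨mem_exchange.2 (.inr (.inr rfl)), ho⟩
  have hmem : ∀ k ∈ T ∩ O, k ≠ p → k ∈ M.exchange T p h ∩ O := fun k hk hkp =>
    ⟨mem_exchange.2 (.inl ⟨hk.1, hkp, fun he => (hT.alpha.1 p).1 (he ▸ hk.2) hp.2⟩), hk.2⟩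
  have hr1 : ∀ {u}, M.Reaches (T ∩ O) u M.rootVertex →
      ¬ M.Reaches (T ∩ O) u (M.vert (M.opp h)) →
      M.Reaches (M.exchange T p h ∩ O) u M.rootVertex := by
    intro u hu
    induction hu using Relation.ReflTransGen.head_induction_on with
    | refl => exact fun _ => .refl
    | head hs _ ih =>
      obtain ⟨k, hk, rfl, rfl⟩ := hs
      intro hn
      refine Reaches.head (hmem k hk ?_) (ih fun h => hn (Reaches.head hk h))
      rintro rfl
      rw [hpx] at hn
      exact hn .refl
  have hx : M.Reaches (M.exchange T p h ∩ O) (M.vert (M.opp h)) M.rootVertex := by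
    refine Reaches.head hoh ?_
    rw [M.opp_opp]
    exact hr1 (hR.internal _) hv
  have hr2 : ∀ {u}, M.Reaches (T ∩ O) u (M.vert (M.opp h)) →
      M.Reaches (M.exchange T p h ∩ O) u M.rootVertex := by
    intro u hu
    induction hu using Relation.ReflTransGen.head_induction_on with
    | refl => exact hx
    | head hs _ ih =>
      obtain ⟨k, hk, rfl, rfl⟩ := hs
      by_cases hkp : k = p
      · rw [hkp, hpx]
        exact hx
      · exact Reaches.head (hmem k hk hkp) ih
  have hr : ∀ v, M.Reaches (M.exchange T p h ∩ O) v M.rootVertex := fun v => by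
    by_cases h : M.Reaches (T ∩ O) v (M.vert (M.opp h))
    · exact hr2 h
    · exact hr1 (hR.internal _) h
  refine ⟨M.exchange T p h, ⟨hT.alpha, hT.compatible,
    isSpanningTree_exchange hT.spanning hp.1 hh Set.inter_subset_left hr,
    disjoint_exchange hT.unmarked hm, hr⟩, hR.statusWord_lt (q := h) (fun k hk => ⟨?_, Iff.rfl⟩) ?_⟩
  -- `h` lies outside the interval of the descendants of its opposite vertex and precedes `M.opp h`,
  -- which lies in it. Hence `h` precedes `M.opp p`, and the first change occurs at `h`.
  · have h1 := hR.reaches_iff_firstTime hp h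
    have h2 := hR.reaches_iff_firstTime hp (M.opp h)
    rw [hpx] at h1 h2
    have h2 := h2.1 .refl
    have h1 := fun hc => hv (h1.2 hc)
    have h3 : k ≠ p := by
      rintro rfl
      omega
    have h4 : k ≠ M.opp p := by
      rintro rfl
      exact h1 ⟨hk, by omega⟩
    have h5 : k ≠ h := by
      rintro rfl
      omega
    have h6 : k ≠ M.opp h := by
      rintro rfl
      omega
    rw [mem_exchange]
    tauto
  · have h1 : h ∈ M.exchange T p h := mem_exchange.2 (.inr (.inl rfl))
    have h2 : h ∉ O := (hT.alpha.1.opp_notMem (h := M.opp h)).2 ho |> fun h' => by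
      rwa [M.opp_opp] at h'
    simp [status, hh, h1, h2]

theorem IsCompatible.flip (hc : M.IsCompatible O) {C : Set M.H}
    (hC : ∀ k ∈ C, k ∉ M.markedHalfEdges) : M.IsCompatible (M.flip O C) := fun k hk =>
  .inl ⟨hc hk, fun h => hC k h (.inl hk)⟩

/-- If an edge that is not in the tree is a loop directed as an ingoing half followed by an
outgoing half, it can be reversed. -/
theorem IsPrecanonical.improve_loop (hT : M.IsPrecanonical α O T) (hh : h ∉ T)
    (hm : h ∉ M.markedHalfEdges) (ho : M.opp h ∈ O)
    (ht : firstTime (M.walk T) M.root h < firstTime (M.walk T) M.root (M.opp h))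
    (hv : M.vert h = M.vert (M.opp h)) :
    ∃ O', M.IsPrecanonical α O' T ∧ M.statusWord O T < M.statusWord O' T := by
  have hR := hT.isRootedTree
  have hC : ∀ k ∈ ({M.opp h} : Set M.H), k ∉ M.markedHalfEdges := by
    rintro _ rfl
    rwa [opp_mem_markedHalfEdges]
  have hohT : M.opp h ∉ T := by rwa [hR.opp_mem]
  have hsub : T ∩ O ⊆ T ∩ M.flip O {M.opp h} := fun k hk => ⟨hk.1, .inl ⟨hk.2, by
    rintro rfl
    exact hohT hk.1⟩⟩
  refine ⟨M.flip O {M.opp h}, ⟨hT.alpha.flip (by simpa using ho) fun v => ?_,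
    hT.compatible.flip hC, hT.spanning, hT.unmarked, fun v =>
    (hT.internal v).mono hsub⟩,
    hR.statusWord_lt (q := h) (fun k hk => ⟨Iff.rfl, ?_⟩) ?_⟩
  · congr 1
    ext k
    simp only [Set.mem_singleton_iff, Set.mem_ofPred_eq]
    refine and_congr_right fun h => ?_
    rw [h, M.opp_opp, hv]
  · have h5 : k ≠ h := by
      rintro rfl
      omega
    have h6 : k ≠ M.opp h := by
      rintro rfl
      omega
    simp [HalfEdgeMap.flip, h6, M.opp_injective.eq_iff, h5]
  · have h2 : h ∉ O := (hT.alpha.1.opp_notMem (h := M.opp h)).2 ho |> fun h' => by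
      rwa [M.opp_opp] at h'
    have h3 : h ∈ M.flip O {M.opp h} := .inr rfl
    simp [status, hh, h2, h3]

/-- If an edge that is not in the tree is first visited by its ingoing half, and starts at
an ancestor of its end, then it can replace a tree edge after reversing a cycle. -/
theorem IsPrecanonical.improve_cycle (hT : M.IsPrecanonical α O T) (hh : h ∉ T)
    (hm : h ∉ M.markedHalfEdges) (ho : M.opp h ∈ O)
    (ht : firstTime (M.walk T) M.root h < firstTime (M.walk T) M.root (M.opp h))
    (hv : M.Reaches (T ∩ O) (M.vert h) (M.vert (M.opp h)))
    (hne : M.vert h ≠ M.vert (M.opp h)) :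
    ∃ O' T', M.IsPrecanonical α O' T' ∧ M.statusWord O T < M.statusWord O' T' := by
  classical
  have hR := hT.isRootedTree
  -- `p` is the last half-edge of the tree path from the vertex of `h` up to that of `M.opp h`.
  -- Below, `K` is this path and `C` the directed cycle that it forms with the external edge.
  obtain ⟨p, hp, hpx, hvc⟩ : ∃ p ∈ T ∩ O, M.vert (M.opp p) = M.vert (M.opp h) ∧
      M.Reaches (T ∩ O) (M.vert h) (M.vert p) := by
    rcases hv.cases_tail with h | ⟨w, h1, p, hp, rfl, h3⟩
    · exact absurd h.symm hne
    · exact ⟨p, hp, h3, h1⟩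
  have hohT : M.opp h ∉ T := by rwa [hR.opp_mem]
  have hhO : h ∉ O := (hT.alpha.1.opp_notMem (h := M.opp h)).2 ho |> fun h' => by
    rwa [M.opp_opp] at h'
  set K : Set M.H := {k | k ∈ T ∩ O ∧ M.Reaches (T ∩ O) (M.vert h) (M.vert k) ∧
    M.Reaches (T ∩ O) (M.vert k) (M.vert p)} with hK
  set C : Set M.H := insert (M.opp h) K with hCdef
  have hpK : p ∈ K := ⟨hp, hvc, .refl⟩
  have hohK : M.opp h ∉ K := fun h => hohT h.1.1
  have hCO : C ⊆ O := by
    rintro k (rfl | hk)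
    · exact ho
    · exact hk.1.2
  have hC : ∀ k ∈ C, k ∉ M.markedHalfEdges := by
    rintro k (rfl | hk)
    · rwa [opp_mem_markedHalfEdges]
    · exact Set.disjoint_left.1 hT.unmarked hk.1.1
  have hbal : ∀ v, {k | k ∈ C ∧ M.vert k = v}.ncard =
      {k | k ∈ C ∧ M.vert (M.opp k) = v}.ncard := by
    intro y
    have h1 := hR.path_balance hp hvc y
    have h2 : ∀ φ : M.H → M.Vertex, {k | k ∈ C ∧ φ k = y}.ncard =
        {k | k ∈ K ∧ φ k = y}.ncard + (if y = φ (M.opp h) then 1 else 0) := by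
      intro φ
      by_cases hy : y = φ (M.opp h)
      · rw [if_pos hy, ← Set.ncard_insert_of_notMem (a := M.opp h) fun h => hohK h.1]
        congr 1
        ext x
        simp only [Set.mem_ofPred_eq, Set.mem_insert_iff, hCdef]
        constructor
        · rintro ⟨rfl | h, h'⟩
          · exact .inl rfl
          · exact .inr ⟨h, h'⟩
        · rintro (rfl | ⟨h, h'⟩)
          · exact ⟨.inl rfl, hy.symm⟩
          · exact ⟨.inr h, h'⟩
      · rw [if_neg hy]
        congr 1
        ext x
        simp only [Set.mem_ofPred_eq, hCdef, Set.mem_insert_iff]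
        constructor
        · rintro ⟨rfl | h, h'⟩
          · exact absurd h'.symm hy
          · exact ⟨h, h'⟩
        · exact fun h => ⟨.inr h.1, h.2⟩
    rw [hpx] at h1
    rw [h2, h2 fun k => M.vert (M.opp k), M.opp_opp]
    simp only [hK, Set.mem_ofPred_eq] at h1 ⊢
    omega
  have hA : M.IsAlphaOrientation α (M.flip O C) := hT.alpha.flip hCO hbal
  set T' := M.exchange T p h with hT'
  set O' := M.flip O C with hO'
  have hmem : ∀ k ∈ T ∩ O, k ∉ K → k ∈ T' ∩ O' := fun k hk hkK =>
    ⟨mem_exchange.2 (.inl ⟨hk.1, fun he => hkK (he ▸ hpK),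
      fun he => (hT.alpha.1 p).1 (he ▸ hk.2) hp.2⟩),
      .inl ⟨hk.2, by
        rintro (rfl | h)
        · exact hohT hk.1
        · exact hkK h⟩⟩
  have hmem' : ∀ k ∈ K, k ≠ p → M.opp k ∈ T' ∩ O' := fun k hk hkp =>
    ⟨(opp_mem_exchange hT.spanning.opp_mem_iff k).2 (mem_exchange.2 (.inl ⟨hk.1.1, hkp,
      fun he => (hT.alpha.1 p).1 (he ▸ hk.1.2) hp.2⟩)), .inr (by
      rw [M.opp_opp]
      exact .inr hk)⟩
  have hhmem : h ∈ T' ∩ O' := ⟨mem_exchange.2 (.inr (.inl rfl)), .inr (.inl rfl)⟩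
  -- In the new tree, vertices not below `p` keep their old path, and the vertex of `h` leaves
  -- through `h`. A vertex on the path `K` follows the reversed edges back to the vertex of `h`, and
  -- any other descendant first follows its old path until it meets `K`.
  have hr1 : ∀ {u}, M.Reaches (T ∩ O) u M.rootVertex →
      ¬ M.Reaches (T ∩ O) u (M.vert p) → M.Reaches (T' ∩ O') u M.rootVertex := by
    intro u hu
    induction hu using Relation.ReflTransGen.head_induction_on with
    | refl => exact fun _ => .refl
    | head hs _ ih =>
      obtain ⟨k, hk, rfl, rfl⟩ := hs
      intro hn
      exact Reaches.head (hmem k hk fun h => hn h.2.2) (ih fun h => hn (Reaches.head hk h))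
  have hx : M.Reaches (T' ∩ O') (M.vert h) M.rootVertex := by
    refine Reaches.head hhmem (hr1 (hR.internal _) ?_)
    rw [← hpx]
    exact hR.not_reaches hp
  have hr2 : ∀ {y}, M.Reaches (T ∩ O) (M.vert h) y → M.Reaches (T ∩ O) y (M.vert p) →
      M.Reaches (T' ∩ O') y M.rootVertex := by
    intro y hy
    induction hy with
    | refl => exact fun _ => hx
    | tail h1 hs ih =>
      obtain ⟨k, hk, rfl, rfl⟩ := hs
      intro h2
      have hkp : k ≠ p := by
        rintro rfl
        exact hR.not_reaches hk h2
      refine Reaches.head (hmem' k ⟨hk, h1, Reaches.head hk h2⟩ hkp) ?_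
      rw [M.opp_opp]
      exact ih (Reaches.head hk h2)
  have hr3 : ∀ {u}, M.Reaches (T ∩ O) u (M.vert p) → M.Reaches (T' ∩ O') u M.rootVertex := by
    intro u hu
    induction hu using Relation.ReflTransGen.head_induction_on with
    | refl => exact hr2 hvc .refl
    | head hs h1 ih =>
      obtain ⟨k, hk, rfl, rfl⟩ := hs
      by_cases hkK : k ∈ K
      · exact hr2 hkK.2.1 hkK.2.2
      · exact Reaches.head (hmem k hk hkK) ih
  have hr : ∀ v, M.Reaches (T' ∩ O') v M.rootVertex := fun v => by
    by_cases h : M.Reaches (T ∩ O) v (M.vert p)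
    · exact hr3 h
    · exact hr1 (hR.internal _) h
  refine ⟨O', T', ⟨hA, hT.compatible.flip hC,
    isSpanningTree_exchange hT.spanning hp.1 hh Set.inter_subset_left hr,
    disjoint_exchange hT.unmarked hm, hr⟩, hR.statusWord_lt (q := M.opp p) (fun k hk => ?_) ?_⟩
  -- Every modified half-edge except `M.opp p` is at a descendant of the vertex of `p`, or is `M.opp
  -- h`, which follows `h`; so nothing changes before `M.opp p`.
  · have hlate : ∀ k', M.Reaches (T ∩ O) (M.vert k') (M.vert p) →
        firstTime (M.walk T) M.root (M.opp p) < firstTime (M.walk T) M.root k' :=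
      fun k' hk' => ((hR.reaches_iff_firstTime hp k').1 hk').1
    have hp1 := hlate p .refl
    have hh1 := hlate h hvc
    have h3 : k ≠ p := by
      rintro rfl
      omega
    have h4 : k ≠ M.opp p := by
      rintro rfl
      omega
    have h5 : k ≠ h := by
      rintro rfl
      omega
    have h6 : k ≠ M.opp h := by
      rintro rfl
      omega
    have h7 : k ∉ K := fun hkK => by
      have := hlate k hkK.2.2
      omega
    have h8 : M.opp k ∉ K := fun hkK => by
      by_cases he : M.opp k = p
      · exact h4 (opp_eq_comm.1 he)
      · have hv' : M.vert (M.opp k) ≠ M.vert p := fun hv => he (hR.eq_of_vert_eq hkK.1 hp hv)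
        have := hR.reaches_parent hkK.1 hkK.2.2 hv'
        rw [M.opp_opp] at this
        have := hlate k this
        omega
    refine ⟨?_, ?_⟩
    · rw [hT', mem_exchange]
      tauto
    · simp [hO', HalfEdgeMap.flip, hCdef, h6, h7, h8, M.opp_injective.eq_iff, h5]
  -- The edge of `p` is both reversed and removed from the tree, so `M.opp p` turns from a tree
  -- half-edge into an outgoing external one.
  · have h1 : M.opp p ∈ T := (hR.opp_mem p).2 hp.1
    have h2 : M.opp p ∉ T' := by
      rw [hT', mem_exchange]
      rintro (h | h | h)
      · exact h.2.2 rfl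
      · exact hh (h ▸ h1)
      · exact hohT (h ▸ h1)
    have h3 : M.opp p ∈ O' := .inr (by
      rw [M.opp_opp]
      exact .inr hpK)
    simp [status, h1, h2, h3]

theorem IsPrecanonical.improve (hT : M.IsPrecanonical α O T) (hh : h ∉ T)
    (hm : h ∉ M.markedHalfEdges) (ho : M.opp h ∈ O)
    (ht : firstTime (M.walk T) M.root h < firstTime (M.walk T) M.root (M.opp h)) :
    ∃ O' T', M.IsPrecanonical α O' T' ∧ M.statusWord O T < M.statusWord O' T' := by
  by_cases hv : M.Reaches (T ∩ O) (M.vert h) (M.vert (M.opp h))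
  · by_cases hne : M.vert h = M.vert (M.opp h)
    · obtain ⟨O', hO'⟩ := hT.improve_loop hh hm ho ht hne
      exact ⟨O', T, hO'⟩
    · exact hT.improve_cycle hh hm ho ht hv hne
  · obtain ⟨T', hT'⟩ := hT.improve_tree hh hm ho ht hv
    exact ⟨O, T', hT'⟩

/-- There are finitely many pairs, so one has a maximal status word; a violation of the external
rule would allow an improvement. -/
theorem exists_isCanonical (hO : M.IsAlphaOrientation α O) (hc : M.IsCompatible O)
    (ha : M.IsRootAccessible O) : ∃ O T, M.IsCanonical α O T := by
  obtain ⟨T, hT⟩ := exists_isPrecanonical hO hc ha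
  have : Nonempty {p : Set M.H × Set M.H // M.IsPrecanonical α p.1 p.2} := ⟨⟨(O, T), hT⟩⟩
  obtain ⟨⟨⟨O, T⟩, hT⟩, hmax⟩ := Finite.exists_max
    fun p : {p : Set M.H × Set M.H // M.IsPrecanonical α p.1 p.2} =>
      M.statusWord p.1.1 p.1.2
  have key : ∀ h, h ∉ T → h ∉ M.markedHalfEdges → M.opp h ∈ O →
      ¬ firstTime (M.walk T) M.root h < firstTime (M.walk T) M.root (M.opp h) := by
    intro h hh hm ho ht
    obtain ⟨O', T', h', hlt⟩ := hT.improve hh hm ho ht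
    exact absurd (hmax ⟨(O', T'), h'⟩) (not_le.2 hlt)
  have hR := hT.isRootedTree
  refine ⟨O, T, hT.alpha, hT.compatible, hT.spanning, hT.unmarked, hT.internal,
    fun h hh hm => ?_⟩
  rw [visitedBefore_iff (hR.exists_iterate _) (hR.exists_iterate _)]
  constructor
  · intro ho
    have h1 := key (M.opp h) (by rwa [hR.opp_mem]) (by rwa [opp_mem_markedHalfEdges])
      (by rwa [M.opp_opp])
    rw [M.opp_opp] at h1
    refine lt_of_le_of_ne (not_lt.1 h1) fun he => M.opp_ne h ?_
    exact (firstTime_injective (hR.exists_iterate _) (hR.exists_iterate _) he).symm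
  · intro ht
    by_contra ho
    exact key h hh hm ((hT.alpha.1 h).2 ho) ht

end MarkedMap

/-! ### Cutting edges: the tree property and the order of the leaves -/

open HalfEdgeMap

section VisitedAt

variable {X : Type} {f : X → X} {r x y : X} {n : ℕ}

/-- The sequence `r, f r, f (f r), ...` is at `x` at time `n` and it has not met `y` yet. -/
def VisitedAt (f : X → X) (r x y : X) (n : ℕ) : Prop := f^[n] r = x ∧ ∀ m ≤ n, f^[m] r ≠ y

theorem visitedAt_zero : VisitedAt f r x y 0 ↔ r = x ∧ r ≠ y := by
  simp [VisitedAt]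

theorem visitedAt_succ : VisitedAt f r x y (n + 1) ↔ r ≠ y ∧ VisitedAt f (f r) x y n := by
  constructor
  · rintro ⟨h1, h2⟩
    exact ⟨h2 0 (Nat.zero_le _), h1, fun m hm => h2 (m + 1) (by omega)⟩
  · rintro ⟨h1, h2, h3⟩
    refine ⟨h2, fun m hm => ?_⟩
    cases m with
    | zero => exact h1
    | succ m => exact h3 m (by omega)

end VisitedAt

namespace HalfEdgeMap

open Classical in
/-- The map obtained by cutting in their middles the edges of `M` that are not in `T`. -/
noncomputable def cutMap (M : HalfEdgeMap) (T : Set M.H) (hT : ∀ h, M.opp h ∈ T ↔ h ∈ T)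
    (r : {h : M.H // h ∉ T}) : HalfEdgeMap where
  H := M.H ⊕ {h : M.H // h ∉ T}
  finite := by
    have := M.finite
    infer_instance
  σ := Equiv.sumCongr M.σ (Equiv.refl _)
  opp := Sum.elim (fun h => if hh : h ∈ T then Sum.inl (M.opp h) else Sum.inr ⟨h, hh⟩)
    (fun x => Sum.inl x.1)
  opp_opp := by
    rintro (h | ⟨h, hh⟩)
    · by_cases hh : h ∈ T
      · simp [hh, hT, M.opp_opp]
      · simp [hh]
    · simp [hh]
  opp_ne := by
    rintro (h | ⟨h, hh⟩)
    · by_cases hh : h ∈ T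
      · simp [hh, M.opp_ne]
      · simp [hh]
    · simp
  root := Sum.inr r

section CutMap

variable {M : HalfEdgeMap} {T : Set M.H} {hT : ∀ h, M.opp h ∈ T ↔ h ∈ T} {r : {h : M.H // h ∉ T}}

/-- The half-edge of the cut map that comes from a half-edge of `M`. -/
abbrev cutInl (M : HalfEdgeMap) (T : Set M.H) (hT : ∀ h, M.opp h ∈ T ↔ h ∈ T)
    (r : {h : M.H // h ∉ T}) (h : M.H) : (M.cutMap T hT r).H := Sum.inl h

/-- A leaf of the cut map. -/
abbrev cutInr (M : HalfEdgeMap) (T : Set M.H) (hT : ∀ h, M.opp h ∈ T ↔ h ∈ T)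
    (r : {h : M.H // h ∉ T}) (x : {h : M.H // h ∉ T}) : (M.cutMap T hT r).H := Sum.inr x

theorem cutInl_injective : Function.Injective (M.cutInl T hT r) := Sum.inl_injective

theorem cutInr_injective : Function.Injective (M.cutInr T hT r) := Sum.inr_injective

theorem cutInl_ne_cutInr (h : M.H) (x : {h : M.H // h ∉ T}) :
    M.cutInl T hT r h ≠ M.cutInr T hT r x := Sum.inl_ne_inr

theorem cutMap_opp_of_mem {h : M.H} (hh : h ∈ T) :
    (M.cutMap T hT r).opp (M.cutInl T hT r h) = M.cutInl T hT r (M.opp h) := by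
  simp [cutMap, cutInl, hh]

theorem cutMap_opp_of_notMem {h : M.H} (hh : h ∉ T) :
    (M.cutMap T hT r).opp (M.cutInl T hT r h) = M.cutInr T hT r ⟨h, hh⟩ := by
  simp [cutMap, cutInl, hh]

theorem cutMap_opp_inr (x : {h : M.H // h ∉ T}) :
    (M.cutMap T hT r).opp (M.cutInr T hT r x) = M.cutInl T hT r x.1 := rfl

theorem cutMap_zpow (n : ℤ) :
    (M.cutMap T hT r).σ ^ n = Equiv.sumCongr (M.σ ^ n) (Equiv.refl _) := by
  change (Equiv.Perm.sumCongrHom M.H {h : M.H // h ∉ T} (M.σ, 1)) ^ n = _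
  rw [← map_zpow]
  simp [Prod.pow_mk, Equiv.Perm.sumCongrHom]
  rfl

theorem cutMap_vert_inl {h k : M.H} :
    (M.cutMap T hT r).vert (M.cutInl T hT r h) = (M.cutMap T hT r).vert (M.cutInl T hT r k) ↔
      M.vert h = M.vert k := by
  simp only [vert_eq_iff, Equiv.Perm.SameCycle, cutMap_zpow]
  exact exists_congr fun n => Sum.inl_injective.eq_iff

theorem cutMap_vert_inr {x : {h : M.H // h ∉ T}} {y : (M.cutMap T hT r).H} :
    (M.cutMap T hT r).vert (M.cutInr T hT r x) = (M.cutMap T hT r).vert y ↔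
      y = M.cutInr T hT r x := by
  simp only [vert_eq_iff, Equiv.Perm.SameCycle, cutMap_zpow]
  exact ⟨fun ⟨n, hn⟩ => hn.symm, fun h => ⟨0, h.symm⟩⟩

theorem cutMap_degree_inl (h : M.H) :
    (M.cutMap T hT r).degree ((M.cutMap T hT r).vert (M.cutInl T hT r h)) =
      M.degree (M.vert h) := by
  rw [degree, degree, ← Set.ncard_image_of_injective _ (cutInl_injective (hT := hT) (r := r))]
  congr 1
  ext x
  constructor
  · rcases x with x | x
    · exact fun hx => ⟨x, cutMap_vert_inl.1 hx, rfl⟩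
    · exact fun hx => absurd (cutMap_vert_inr.1 hx) (cutInl_ne_cutInr _ _)
  · rintro ⟨y, hy, rfl⟩
    exact cutMap_vert_inl.2 hy

theorem cutMap_isLeaf_inr (x : {h : M.H // h ∉ T}) :
    (M.cutMap T hT r).IsLeaf (M.cutInr T hT r x) := by
  rw [IsLeaf, degree, Set.ncard_eq_one]
  refine ⟨M.cutInr T hT r x, ?_⟩
  ext y
  rw [Set.mem_ofPred_eq, eq_comm, cutMap_vert_inr]
  rfl

theorem cutMap_isLeaf_inl (h : M.H) :
    (M.cutMap T hT r).IsLeaf (M.cutInl T hT r h) ↔ M.IsLeaf h := by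
  rw [IsLeaf, cutMap_degree_inl, IsLeaf]

/-- The vertices of the cut map are the vertices of `M` and the new leaves. -/
noncomputable def cutVertexEquiv (M : HalfEdgeMap) (T : Set M.H) (hT : ∀ h, M.opp h ∈ T ↔ h ∈ T)
    (r : {h : M.H // h ∉ T}) : M.Vertex ⊕ {h : M.H // h ∉ T} ≃ (M.cutMap T hT r).Vertex :=
  Equiv.ofBijective
    (Sum.elim (Quotient.lift (fun h => (M.cutMap T hT r).vert (M.cutInl T hT r h)) fun _ _ h =>
      cutMap_vert_inl.2 (Quotient.sound h))
      fun x => (M.cutMap T hT r).vert (M.cutInr T hT r x)) <| by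
    constructor
    · rintro (u | x) (v | y) huv
      · obtain ⟨h, rfl⟩ := M.vert_surjective u
        obtain ⟨k, rfl⟩ := M.vert_surjective v
        exact congrArg _ (cutMap_vert_inl.1 huv)
      · obtain ⟨h, rfl⟩ := M.vert_surjective u
        exact absurd (cutMap_vert_inr.1 huv.symm) (cutInl_ne_cutInr _ _)
      · obtain ⟨h, rfl⟩ := M.vert_surjective v
        exact absurd (cutMap_vert_inr.1 huv) (cutInl_ne_cutInr _ _)
      · exact congrArg Sum.inr (cutInr_injective (cutMap_vert_inr.1 huv).symm)
    · intro u
      obtain ⟨h | x, rfl⟩ := (M.cutMap T hT r).vert_surjective u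
      · exact ⟨Sum.inl (M.vert h), rfl⟩
      · exact ⟨Sum.inr x, rfl⟩

theorem cutVertexEquiv_inl (h : M.H) : M.cutVertexEquiv T hT r (Sum.inl (M.vert h)) =
    (M.cutMap T hT r).vert (M.cutInl T hT r h) := rfl

theorem cutVertexEquiv_inr (x : {h : M.H // h ∉ T}) : M.cutVertexEquiv T hT r (Sum.inr x) =
    (M.cutMap T hT r).vert (M.cutInr T hT r x) := rfl

theorem cutMap_nodeCount {d : ℕ} (hd : d ≠ 1) :
    (M.cutMap T hT r).nodeCount d = M.vertexCount d := by
  symm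
  refine Nat.card_congr (Equiv.ofBijective (fun v => ⟨M.cutVertexEquiv T hT r (Sum.inl v.1), ?_⟩) ?_)
  · obtain ⟨v, hv⟩ := v
    obtain ⟨h, rfl⟩ := M.vert_surjective v
    have : (M.cutMap T hT r).degree (M.cutVertexEquiv T hT r (Sum.inl (M.vert h))) = d := by
      rw [cutVertexEquiv_inl, cutMap_degree_inl, hv]
    exact ⟨by rwa [IsNode, this], this⟩
  · constructor
    · intro u v huv
      simpa [Subtype.ext_iff] using huv
    · rintro ⟨v, hv, hd⟩
      obtain ⟨u | x, rfl⟩ := (M.cutVertexEquiv T hT r).surjective v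
      · refine ⟨⟨u, ?_⟩, rfl⟩
        obtain ⟨h, rfl⟩ := M.vert_surjective u
        rwa [cutVertexEquiv_inl, cutMap_degree_inl] at hd
      · exact absurd (cutMap_isLeaf_inr x) hv

/-- Each half-edge outside `T` adds one half-edge and one vertex, and `2 * (number of vertices)`
grows by two for it; the difference is compensated by the half-edge itself, which `T.ncard` does not
count. -/
theorem cutMap_card_iff : (Set.univ : Set (M.cutMap T hT r).H).ncard + 2 =
    2 * Nat.card (M.cutMap T hT r).Vertex ↔ T.ncard + 2 = 2 * Nat.card M.Vertex := by
  rw [← Nat.card_congr (M.cutVertexEquiv T hT r), Nat.card_sum, Set.ncard_univ]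
  have h1 : Nat.card (M.cutMap T hT r).H = Nat.card M.H + Nat.card {h : M.H // h ∉ T} :=
    Nat.card_sum
  have h2 := Set.ncard_add_ncard_compl T
  have h3 : Tᶜ.ncard = Nat.card {h : M.H // h ∉ T} := rfl
  omega

/-- Contracting each new leaf onto the vertex that carries it turns paths of the cut map into paths
along `T`. Conversely, paths along `T` survive the cutting, and each new leaf is attached to an old
vertex. -/
theorem cutMap_isTree_iff : (M.cutMap T hT r).IsTree ↔ M.IsSpanningTree T := by
  set C := M.cutMap T hT r
  constructor
  · intro h
    refine ⟨hT, fun u v => ?_, cutMap_card_iff.1 h.card_eq⟩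
    let φ : C.Vertex → M.Vertex := fun x =>
      Sum.elim id (fun y => M.vert y.1) ((M.cutVertexEquiv T hT r).symm x)
    have hl : ∀ k, φ (C.vert (M.cutInl T hT r k)) = M.vert k := fun k => by
      simp only [φ, C]
      rw [← cutVertexEquiv_inl, Equiv.symm_apply_apply]
      rfl
    have hr : ∀ x, φ (C.vert (M.cutInr T hT r x)) = M.vert x.1 := fun x => by
      simp only [φ, C]
      rw [← cutVertexEquiv_inr, Equiv.symm_apply_apply]
      rfl
    obtain ⟨a, rfl⟩ := M.vert_surjective u
    obtain ⟨b, rfl⟩ := M.vert_surjective v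
    rw [← hl a, ← hl b]
    refine (h.connects _ _).lift φ ?_
    rintro (k | x) -
    · by_cases hk : k ∈ T
      · have := cutMap_opp_of_mem (hT := hT) (r := r) hk
        change M.Reaches T (φ (C.vert (M.cutInl T hT r k)))
          (φ (C.vert (C.opp (M.cutInl T hT r k))))
        rw [this, hl, hl]
        exact .single hk
      · have := cutMap_opp_of_notMem (hT := hT) (r := r) hk
        change M.Reaches T (φ (C.vert (M.cutInl T hT r k)))
          (φ (C.vert (C.opp (M.cutInl T hT r k))))
        rw [this, hl, hr]
        exact .refl
    · change M.Reaches T (φ (C.vert (M.cutInr T hT r x))) (φ (C.vert (M.cutInl T hT r x.1)))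
      rw [hl, hr]
      exact .refl
  · intro h
    have hl : ∀ a b, C.Reaches Set.univ (C.vert (M.cutInl T hT r a))
        (C.vert (M.cutInl T hT r b)) := by
      intro a b
      refine (h.connects (M.vert a) (M.vert b)).lift
        (fun v => M.cutVertexEquiv T hT r (Sum.inl v)) fun k hk => ?_
      rw [cutVertexEquiv_inl, cutVertexEquiv_inl, ← cutMap_opp_of_mem hk]
      exact .single (Set.mem_univ _)
    have hsymm : ∀ h, C.opp h ∈ (Set.univ : Set C.H) ↔ h ∈ Set.univ := by simp
    have hroot : ∀ u, C.Reaches Set.univ u (C.vert (M.cutInl T hT r r.1)) := by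
      intro u
      obtain ⟨k | x, rfl⟩ := C.vert_surjective u
      · exact hl k r.1
      · exact Reaches.head (M := C) (h := M.cutInr T hT r x) (Set.mem_univ _) (hl x.1 r.1)
    exact ⟨hsymm, fun u v => (hroot u).trans ((hroot v).symm hsymm),
      cutMap_card_iff.2 h.card_eq⟩

theorem cutMap_walk_of_mem {h : M.H} (hh : h ∈ T) :
    (M.cutMap T hT r).walk Set.univ (M.cutInl T hT r h) = M.cutInl T hT r (M.walk T h) := by
  rw [walk, if_pos (Set.mem_univ _), cutMap_opp_of_mem hh, walk, if_pos hh]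
  rfl

theorem cutMap_walk_of_notMem {h : M.H} (hh : h ∉ T) :
    (M.cutMap T hT r).walk Set.univ (M.cutInl T hT r h) = M.cutInr T hT r ⟨h, hh⟩ := by
  rw [walk, if_pos (Set.mem_univ _), cutMap_opp_of_notMem hh]
  rfl

theorem cutMap_walk_inr (x : {h : M.H // h ∉ T}) :
    (M.cutMap T hT r).walk Set.univ (M.cutInr T hT r x) = M.cutInl T hT r (M.walk T x.1) := by
  rw [walk, if_pos (Set.mem_univ _), cutMap_opp_inr, walk, if_neg x.2]
  rfl

/-- The two walks run in parallel: a step across an external half-edge becomes two steps, out to the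
new leaf and back. -/
theorem VisitedAt.cutMap {x y : {h : M.H // h ∉ T}} {n : ℕ} {h : M.H}
    (hv : VisitedAt (M.walk T) h x.1 y.1 n) :
    ∃ m, VisitedAt ((M.cutMap T hT r).walk Set.univ) (M.cutInl T hT r h)
      (M.cutInr T hT r x) (M.cutInr T hT r y) m := by
  induction n generalizing h with
  | zero =>
    obtain ⟨rfl, h2⟩ := visitedAt_zero.1 hv
    refine ⟨1, visitedAt_succ.2 ⟨cutInl_ne_cutInr _ _, ?_⟩⟩
    rw [cutMap_walk_of_notMem x.2]
    exact visitedAt_zero.2 ⟨rfl, fun he => h2 (congrArg Subtype.val (cutInr_injective he))⟩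
  | succ n ih =>
    obtain ⟨h1, h2⟩ := visitedAt_succ.1 hv
    obtain ⟨m, hm⟩ := ih h2
    by_cases hh : h ∈ T
    · rw [← cutMap_walk_of_mem hh] at hm
      exact ⟨m + 1, visitedAt_succ.2 ⟨cutInl_ne_cutInr _ _, hm⟩⟩
    · refine ⟨m + 2, visitedAt_succ.2 ⟨cutInl_ne_cutInr _ _, ?_⟩⟩
      rw [cutMap_walk_of_notMem hh]
      refine visitedAt_succ.2 ⟨fun he => h1 (congrArg Subtype.val (cutInr_injective he)), ?_⟩
      rwa [cutMap_walk_inr]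

theorem VisitedAt.of_cutMap {x y : {h : M.H // h ∉ T}} {n : ℕ} {h : M.H}
    (hv : VisitedAt ((M.cutMap T hT r).walk Set.univ) (M.cutInl T hT r h)
      (M.cutInr T hT r x) (M.cutInr T hT r y) n) : ∃ m, VisitedAt (M.walk T) h x.1 y.1 m := by
  induction n using Nat.strong_induction_on generalizing h with
  | _ n ih =>
  rcases n with _ | n
  · exact absurd (visitedAt_zero.1 hv).1 (cutInl_ne_cutInr _ _)
  have hv := (visitedAt_succ.1 hv).2
  by_cases hh : h ∈ T
  · rw [cutMap_walk_of_mem hh] at hv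
    obtain ⟨m, hm⟩ := ih n (by omega) hv
    exact ⟨m + 1, visitedAt_succ.2 ⟨fun he => y.2 (he ▸ hh), hm⟩⟩
  · rw [cutMap_walk_of_notMem hh] at hv
    rcases n with _ | n
    · obtain ⟨h1, h2⟩ := visitedAt_zero.1 hv
      refine ⟨0, visitedAt_zero.2 ⟨congrArg Subtype.val (cutInr_injective h1), ?_⟩⟩
      rintro rfl
      exact h2 rfl
    · obtain ⟨h1, h2⟩ := visitedAt_succ.1 hv
      rw [cutMap_walk_inr] at h2
      obtain ⟨m, hm⟩ := ih n (by omega) h2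
      refine ⟨m + 1, visitedAt_succ.2 ⟨?_, hm⟩⟩
      rintro rfl
      exact h1 rfl

/-- The clockwise walk around the cut map visits the new leaves in the order in which the walk
around `T` visits the half-edges that are not in `T`. -/
theorem cutMap_visitedBefore_iff (x y : {h : M.H // h ∉ T}) :
    VisitedBefore ((M.cutMap T hT r).walk Set.univ) (M.cutMap T hT r).root
      (M.cutInr T hT r x) (M.cutInr T hT r y) ↔ VisitedBefore (M.walk T) r.1 x.1 y.1 := by
  constructor
  · rintro ⟨n, hn⟩
    have hn : VisitedAt ((M.cutMap T hT r).walk Set.univ) (M.cutInr T hT r r)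
      (M.cutInr T hT r x) (M.cutInr T hT r y) n := hn
    -- The cut map is rooted at the leaf, one step after the half-edge `r` that carries it, hence
    -- the shift by one.
    refine VisitedAt.of_cutMap (n := n + 1) (hT := hT) (r := r) (visitedAt_succ.2
      ⟨cutInl_ne_cutInr _ _, ?_⟩)
    rwa [cutMap_walk_of_notMem r.2]
  · rintro ⟨n, hn⟩
    obtain ⟨m, hm⟩ := VisitedAt.cutMap (hT := hT) (r := r) hn
    rcases m with _ | m
    · exact absurd (visitedAt_zero.1 hm).1 (cutInl_ne_cutInr _ _)
    · have := (visitedAt_succ.1 hm).2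
      rw [cutMap_walk_of_notMem r.2] at this
      exact ⟨m, this⟩

end CutMap

end HalfEdgeMap

/-! ### A canonical pair is cut into a marked Eulerian tree -/

namespace HalfEdgeMap

variable {M : HalfEdgeMap} {O T : Set M.H}

/-- The extra one is the parent half-edge, or, at the root vertex, which has no parent half-edge,
the root half-edge. This is the source of the `k - 1` opening leaves per node. -/
theorem IsRootedTree.outDegree_eq (hT : M.IsRootedTree O T) (hrO : M.root ∈ O) (v : M.Vertex) : M.outDegree O v =
      {k | k ∈ O ∧ k ∉ T ∧ k ≠ M.root ∧ M.vert k = v}.ncard + 1 := by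
  obtain ⟨s, hs, hs'⟩ : ∃ s, s ∉ {k | k ∈ O ∧ k ∉ T ∧ k ≠ M.root ∧ M.vert k = v} ∧
      {k | k ∈ O ∧ M.vert k = v} = insert s {k | k ∈ O ∧ k ∉ T ∧ k ≠ M.root ∧ M.vert k = v} := by
    by_cases hv : v = M.rootVertex
    · refine ⟨M.root, fun h => h.2.2.1 rfl, ?_⟩
      ext k
      simp only [Set.mem_ofPred_eq, Set.mem_insert_iff]
      constructor
      · rintro ⟨h1, h2⟩
        by_cases hk : k = M.root
        · exact .inl hk
        · exact .inr ⟨h1, fun h => hT.vert_ne_root ⟨h, h1⟩ (h2.trans hv), hk, h2⟩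
      · rintro (rfl | ⟨h1, -, -, h2⟩)
        · exact ⟨hrO, hv.symm⟩
        · exact ⟨h1, h2⟩
    · obtain ⟨p, hp, rfl⟩ := hT.exists_parent hv
      refine ⟨p, fun h => h.2.1 hp.1, ?_⟩
      ext k
      simp only [Set.mem_ofPred_eq, Set.mem_insert_iff]
      constructor
      · rintro ⟨h1, h2⟩
        by_cases hk : k ∈ T
        · exact .inl (hT.eq_of_vert_eq ⟨hk, h1⟩ hp h2)
        · refine .inr ⟨h1, hk, ?_, h2⟩
          rintro rfl
          exact hv h2.symm
      · rintro (rfl | ⟨h1, -, -, h2⟩)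
        · exact ⟨hp.2, rfl⟩
        · exact ⟨h1, h2⟩
  rw [outDegree, hs', Set.ncard_insert_of_notMem hs]

theorem IsEulerian.not_isLeaf (hM : M.IsEulerian) (h : M.H) : ¬ M.IsLeaf h := by
  intro hl
  have := hM (M.vert h)
  rw [IsLeaf] at hl
  rw [hl] at this
  exact absurd this (by decide)

theorem IsEulerian.degree_eq (hM : M.IsEulerian) (v : M.Vertex) :
    M.degree v = 2 * M.halfDegree v := (Nat.two_mul_div_two_of_even (hM v)).symm

end HalfEdgeMap

namespace MarkedMap

section Cut

variable {M : MarkedMap} {O T : Set M.H} {hT : ∀ h, M.opp h ∈ T ↔ h ∈ T} {hr : M.root ∉ T}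

/-- Even degrees exclude degree one, so the leaves of the cut tree are exactly those created by
cutting; an isomorphism of cut trees must therefore respect the two summands. -/
theorem isLeaf_cut_iff (hM : M.IsEulerian) (x : (M.cut O T hT hr).H) :
    (M.cut O T hT hr).IsLeaf x ↔ ∃ y, x = Sum.inr y := by
  rcases x with x | x
  · refine ⟨fun h => absurd ((cutMap_isLeaf_inl (hT := hT) (r := ⟨M.root, hr⟩) x).1 h) (hM.not_isLeaf x), ?_⟩
    rintro ⟨y, hy⟩
    exact absurd hy Sum.inl_ne_inr
  · exact ⟨fun _ => ⟨x, rfl⟩, fun _ => cutMap_isLeaf_inr (hT := hT) (r := ⟨M.root, hr⟩) x⟩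

theorem mem_closing_cut (hM : M.IsEulerian) (x : (M.cut O T hT hr).H) :
    x ∈ (M.cut O T hT hr).closing ↔ ∃ y, x = Sum.inr y ∧ y.1 ∉ O := by
  refine (and_congr_left' (isLeaf_cut_iff hM x)).trans ?_
  constructor
  · rintro ⟨⟨y, rfl⟩, h⟩
    exact ⟨y, rfl, fun hy => h ⟨y, rfl, hy⟩⟩
  · rintro ⟨y, rfl, hy⟩
    refine ⟨⟨y, rfl⟩, ?_⟩
    rintro ⟨z, hz, hz'⟩
    obtain rfl := Sum.inr_injective hz
    exact hy hz'

theorem isBlossomingTree_cut (hM : M.IsEulerian) (hO : M.IsOrientation O)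
    (hsp : M.IsSpanningTree T) (hrO : M.root ∈ O) : (M.cut O T hT hr).IsBlossomingTree where
  tree := (cutMap_isTree_iff (hT := hT) (r := ⟨M.root, hr⟩)).2 hsp
  leaf_of_opening := by
    rintro _ ⟨y, rfl, -⟩
    exact (isLeaf_cut_iff hM _).2 ⟨y, rfl⟩
  root_opening := ⟨_, rfl, hrO⟩
  card_eq := by
    -- Exchanging the halves of each cut edge maps opening leaves onto closing leaves.
    let φ : {h : M.H // h ∉ T} → {h : M.H // h ∉ T} := fun x => ⟨M.opp x.1, (hT x.1).not.2 x.2⟩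
    have hφ : ∀ x, φ (φ x) = x := fun x => Subtype.ext (M.opp_opp _)
    have h1 : (M.cut O T hT hr).opening =
        M.cutInr T hT ⟨M.root, hr⟩ '' {x | x.1 ∈ O} := by
      ext x
      constructor
      · rintro ⟨y, rfl, hy⟩
        exact ⟨y, hy, rfl⟩
      · rintro ⟨y, hy, rfl⟩
        exact ⟨y, rfl, hy⟩
    have h2 : (M.cut O T hT hr).closing =
        M.cutInr T hT ⟨M.root, hr⟩ '' (φ '' {x | x.1 ∈ O}) := by
      ext x
      rw [mem_closing_cut hM]
      constructor
      · rintro ⟨y, rfl, hy⟩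
        exact ⟨y, ⟨φ y, (hO _).2 hy, hφ y⟩, rfl⟩
      · rintro ⟨_, ⟨y, hy, rfl⟩, rfl⟩
        exact ⟨_, rfl, hO.opp_notMem.2 hy⟩
    have e1 := Set.ncard_image_of_injective {x : {h : M.H // h ∉ T} | x.1 ∈ O}
      (cutInr_injective (hT := hT) (r := ⟨M.root, hr⟩))
    have e2 := Set.ncard_image_of_injective (φ '' {x : {h : M.H // h ∉ T} | x.1 ∈ O})
      (cutInr_injective (hT := hT) (r := ⟨M.root, hr⟩))
    rw [Set.ncard_image_of_injective _ (Function.LeftInverse.injective hφ), ← e1, ← h2] at e2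
    exact (congrArg Set.ncard h1).trans e2.symm

theorem ncard_opening_cut (h : M.H) : {o | o ∈ (M.cut O T hT hr).opening ∧
    o ≠ (M.cut O T hT hr).root ∧ (M.cut O T hT hr).vert ((M.cut O T hT hr).opp o) =
      (M.cutMap T hT ⟨M.root, hr⟩).vert (M.cutInl T hT ⟨M.root, hr⟩ h)}.ncard =
    {k | k ∈ O ∧ k ∉ T ∧ k ≠ M.root ∧ M.vert k = M.vert h}.ncard := by
  set A := {x : {h : M.H // h ∉ T} | x.1 ∈ O ∧ x.1 ≠ M.root ∧ M.vert x.1 = M.vert h}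
  have h1 : {k | k ∈ O ∧ k ∉ T ∧ k ≠ M.root ∧ M.vert k = M.vert h} = Subtype.val '' A := by
    ext k
    constructor
    · rintro ⟨h1, h2, h3⟩
      exact ⟨⟨k, h2⟩, ⟨h1, h3⟩, rfl⟩
    · rintro ⟨⟨k, h2⟩, ⟨h1, h3⟩, rfl⟩
      exact ⟨h1, h2, h3⟩
  rw [h1, Set.ncard_image_of_injective _ Subtype.val_injective,
    ← Set.ncard_image_of_injective A (cutInr_injective (hT := hT) (r := ⟨M.root, hr⟩))]
  refine congrArg Set.ncard (?_ : _ = M.cutInr T hT ⟨M.root, hr⟩ '' A)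
  ext x
  constructor
  · rintro ⟨⟨y, rfl, hy⟩, h2, h3⟩
    exact ⟨y, ⟨hy, fun he => h2 (congrArg Sum.inr (Subtype.ext he)),
      (cutMap_vert_inl (r := ⟨M.root, hr⟩)).1 h3⟩, rfl⟩
  · rintro ⟨y, ⟨h1, h2, h3⟩, rfl⟩
    exact ⟨⟨y, rfl, h1⟩, fun he => h2 (congrArg Subtype.val (cutInr_injective he)),
      cutMap_vert_inl.2 h3⟩

theorem isEulerianTree_cut (hM : M.IsEulerian) (h : M.IsCanonical M.halfDegree O T)
    (hrO : M.root ∈ O) : (M.cut O T hT hr).IsEulerianTree := by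
  intro v hv
  obtain ⟨x | x, rfl⟩ := (M.cut O T hT hr).vert_surjective v
  · refine ⟨M.halfDegree (M.vert x), ?_, ?_⟩
    · rw [← hM.degree_eq]
      exact cutMap_degree_inl (hT := hT) (r := ⟨M.root, hr⟩) x
    · rw [← h.alpha.2, h.isRootedTree.outDegree_eq hrO]
      exact congrArg (· + 1) (ncard_opening_cut x)
  · exact absurd (cutMap_isLeaf_inr (hT := hT) (r := ⟨M.root, hr⟩) x) hv

theorem isMarkedMatching_cut (hM : M.IsEulerian) (h : M.IsCanonical M.halfDegree O T) :
    (M.cut O T hT hr).IsMarkedMatching where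
  mem := by
    rintro _ ⟨x, y, rfl, hy, hx⟩
    exact ⟨⟨x, rfl, hx⟩, (mem_closing_cut hM _).2 ⟨y, rfl, by rwa [hy, h.alpha.1.opp_notMem]⟩⟩
  existsUnique_closing := by
    rintro _ ⟨x, rfl, hx⟩
    refine ⟨Sum.inr ⟨M.opp x.1, (hT x.1).not.2 x.2⟩, ⟨x, _, rfl, rfl, hx⟩, ?_⟩
    rintro _ ⟨x', y, he, hy, -⟩
    obtain ⟨h1, rfl⟩ := Prod.ext_iff.1 he
    obtain rfl := Sum.inr_injective h1
    exact congrArg Sum.inr (Subtype.ext hy)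
  existsUnique_opening := by
    intro c hc
    obtain ⟨y, rfl, hy⟩ := (mem_closing_cut hM _).1 hc
    refine ⟨Sum.inr ⟨M.opp y.1, (hT y.1).not.2 y.2⟩,
      ⟨_, y, rfl, (M.opp_opp _).symm, (h.alpha.1 _).2 hy⟩, ?_⟩
    rintro _ ⟨x, y', he, hy, -⟩
    obtain ⟨rfl, h1⟩ := Prod.ext_iff.1 he
    obtain rfl := Sum.inr_injective h1
    exact congrArg Sum.inr (Subtype.ext (opp_eq_comm.1 hy.symm))
  marked_subset := by
    rintro _ ⟨x, y, rfl, hy, hx⟩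
    exact ⟨x, y, rfl, hy, h.compatible hx⟩
  forward := by
    rintro _ ⟨x, y, rfl, hy, hx⟩ hm
    refine (cutMap_visitedBefore_iff (hT := hT) (r := ⟨M.root, hr⟩) x y).2 ?_
    rw [hy]
    have hxm : x.1 ∉ M.markedHalfEdges := fun h' =>
      hm ⟨x, y, rfl, hy, (mem_marked_of_compatible h.alpha.1 h.compatible h').1 hx⟩
    exact (h.external x.1 x.2 hxm).1 hx

theorem ncard_marked_cut (h : M.IsCanonical M.halfDegree O T) :
    (M.cut O T hT hr).marked.ncard = M.marked.ncard := by
  set A := {x : {h : M.H // h ∉ T} | x.1 ∈ M.marked}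
  have h1 : M.marked = Subtype.val '' A := by
    ext k
    refine ⟨fun hk => ⟨⟨k, fun hkT => Set.disjoint_left.1 h.unmarked hkT (.inl hk)⟩, hk, rfl⟩, ?_⟩
    rintro ⟨x, hx, rfl⟩
    exact hx
  let φ : {h : M.H // h ∉ T} → (M.cut O T hT hr).H × (M.cut O T hT hr).H :=
    fun x => (Sum.inr x, Sum.inr ⟨M.opp x.1, (hT x.1).not.2 x.2⟩)
  have hφ : Function.Injective φ := fun x y hxy => Sum.inr_injective (congrArg Prod.fst hxy)
  rw [h1, Set.ncard_image_of_injective _ Subtype.val_injective,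
    ← Set.ncard_image_of_injective A hφ]
  congr 1
  ext p
  constructor
  · rintro ⟨x, y, rfl, hy, hx⟩
    exact ⟨x, hx, Prod.ext rfl (congrArg Sum.inr (Subtype.ext hy.symm))⟩
  · rintro ⟨x, hx, rfl⟩
    exact ⟨x, _, rfl, rfl, hx⟩

theorem isNode_cut (hM : M.IsEulerian) : ∃ v, (M.cut O T hT hr).IsNode v :=
  ⟨(M.cut O T hT hr).vert (Sum.inl M.root), fun h =>
    hM.not_isLeaf _ ((cutMap_isLeaf_inl (hT := hT) (r := ⟨M.root, hr⟩) M.root).1 h)⟩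

theorem nodeCount_eq_of_cutsInto {t : BlossomData} (h : M.CutsInto O T t) {d : ℕ} (hd : d ≠ 1) :
    t.nodeCount d = M.vertexCount d := by
  obtain ⟨hT, hr, e, he, -⟩ := h
  rw [he.nodeCount_eq]
  exact cutMap_nodeCount (hT := hT) (r := ⟨M.root, hr⟩) hd

end Cut

/-! ### Cutting and isomorphism -/

theorem exists_pair_iff {M N : MarkedMap} {e : M.H ≃ N.H} (he : ∀ h, e (M.opp h) = N.opp (e h))
    {S T : Set M.H} {S' T' : Set N.H} (hS : ∀ h, e h ∈ S' ↔ h ∈ S)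
    (e' : {h // h ∉ T} ≃ {h // h ∉ T'}) (h' : ∀ x, (e' x).1 = e x.1) (o c : M.H ⊕ {h // h ∉ T}) :
    (∃ h k, (Equiv.sumCongr e e' o, Equiv.sumCongr e e' c) = (Sum.inr h, Sum.inr k) ∧
      k.1 = N.opp h.1 ∧ h.1 ∈ S') ↔
    ∃ h k, (o, c) = (Sum.inr h, Sum.inr k) ∧ k.1 = M.opp h.1 ∧ h.1 ∈ S := by
  constructor
  · rintro ⟨x, y, hxy, h1, h2⟩
    rcases o with o | o
    · simp at hxy
    rcases c with c | c
    · simp at hxy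
    simp only [Equiv.sumCongr_apply, Sum.map_inr, Prod.mk.injEq, Sum.inr.injEq] at hxy
    obtain ⟨rfl, rfl⟩ := hxy
    refine ⟨o, c, rfl, e.injective ?_, (hS _).1 (h' o ▸ h2)⟩
    rw [← h', h1, h', he]
  · rintro ⟨x, y, hxy, h1, h2⟩
    obtain ⟨rfl, rfl⟩ := Prod.mk.inj hxy
    exact ⟨e' x, e' y, rfl, by rw [h', h', h1, he], by rwa [h', hS]⟩

/-- Isomorphic maps have isomorphic cut maps. -/
theorem cut_isomorphic_of_isIso {M N : MarkedMap} {e : M.H ≃ N.H}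
    (he : HalfEdgeMap.IsIso M.toHalfEdgeMap N.toHalfEdgeMap e)
    (hm : ∀ h, e h ∈ N.marked ↔ h ∈ M.marked) {O T : Set M.H} {O' T' : Set N.H}
    (hO : ∀ h, e h ∈ O' ↔ h ∈ O) (hT : ∀ h, e h ∈ T' ↔ h ∈ T)
    (h1 : ∀ h, M.opp h ∈ T ↔ h ∈ T) (h2 : M.root ∉ T) (h1' : ∀ h, N.opp h ∈ T' ↔ h ∈ T')
    (h2' : N.root ∉ T') : (M.cut O T h1 h2).Isomorphic (N.cut O' T' h1' h2') := by
  let e' : {h // h ∉ T} ≃ {h // h ∉ T'} := e.subtypeEquiv fun h => (hT h).not.symm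
  refine ⟨Equiv.sumCongr e e', ⟨?_, ?_, ?_⟩, ?_, ?_, ?_⟩
  · rintro (x | x)
    · exact congrArg Sum.inl (he.map_σ x)
    · rfl
  · rintro (x | x)
    · by_cases hx : x ∈ T
      · have h3 := cutMap_opp_of_mem (hT := h1) (r := ⟨_, h2⟩) hx
        have h4 := cutMap_opp_of_mem (hT := h1') (r := ⟨_, h2'⟩) ((hT x).2 hx)
        refine (congrArg (Equiv.sumCongr e e') h3).trans (Eq.trans ?_ h4.symm)
        exact congrArg Sum.inl (he.map_opp x)
      · have h3 := cutMap_opp_of_notMem (hT := h1) (r := ⟨_, h2⟩) hx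
        have h4 := cutMap_opp_of_notMem (hT := h1') (r := ⟨_, h2'⟩) ((hT x).not.2 hx)
        exact (congrArg (Equiv.sumCongr e e') h3).trans (Eq.trans rfl h4.symm)
    · rfl
  · exact congrArg Sum.inr (Subtype.ext he.map_root)
  · rintro (x | x)
    · constructor <;> rintro ⟨y, hy, -⟩ <;> exact absurd hy Sum.inl_ne_inr
    · constructor
      · rintro ⟨y, hy, h⟩
        obtain rfl := Sum.inr_injective hy
        exact ⟨x, rfl, (hO _).1 h⟩
      · rintro ⟨y, hy, h⟩
        obtain rfl := Sum.inr_injective hy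
        exact ⟨_, rfl, (hO _).2 h⟩
  · exact exists_pair_iff he.map_opp hO e' fun _ => rfl
  · exact exists_pair_iff he.map_opp hm e' fun _ => rfl

/-- Maps with isomorphic cut maps are isomorphic. -/
theorem isomorphic_of_cut {M N : MarkedMap} {O T : Set M.H} {O' T' : Set N.H}
    {h1 : ∀ h, M.opp h ∈ T ↔ h ∈ T} {h2 : M.root ∉ T} {h1' : ∀ h, N.opp h ∈ T' ↔ h ∈ T'}
    {h2' : N.root ∉ T'} (hM : M.IsEulerian) (hN : N.IsEulerian)
    (hO : M.IsOrientation O) (hm : ∀ h ∈ M.marked, h ∉ T) (hm' : ∀ h ∈ N.marked, h ∉ T')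
    (hiso : (M.cut O T h1 h2).Isomorphic (N.cut O' T' h1' h2')) : M.Isomorphic N := by
  obtain ⟨e, he, ho, hp, hmk⟩ := hiso
  have hinr : ∀ x : (M.cut O T h1 h2).H, (∃ y, e x = Sum.inr y) ↔ ∃ y, x = Sum.inr y := fun x => by
    rw [← isLeaf_cut_iff hN, ← isLeaf_cut_iff hM, he.isLeaf_iff]
  have hinl : ∀ h : M.H, ∃ k : N.H, e (Sum.inl h) = Sum.inl k := by
    intro h
    rcases hk : e (Sum.inl h) with k | k
    · exact ⟨k, rfl⟩
    · obtain ⟨y, hy⟩ := (hinr (Sum.inl h)).1 ⟨k, hk⟩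
      exact absurd hy Sum.inl_ne_inr
  choose f hf using hinl
  have hbij : Function.Bijective f := by
    constructor
    · intro a b hab
      exact Sum.inl_injective (e.injective (by rw [hf, hf, hab]))
    · intro k
      obtain ⟨x | x, hx⟩ := e.surjective (Sum.inl k)
      · exact ⟨x, Sum.inl_injective ((hf x).symm.trans hx)⟩
      · obtain ⟨y, hy⟩ := (hinr (Sum.inr x)).2 ⟨x, rfl⟩
        exact absurd (hx.symm.trans hy) Sum.inl_ne_inr
  have hT : ∀ h ∈ T, f h ∈ T' ∧ f (M.opp h) = N.opp (f h) := by
    intro h hh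
    have h3 : e (Sum.inl (M.opp h)) = (N.cut O' T' h1' h2').opp (Sum.inl (f h)) :=
      ((congrArg e (cutMap_opp_of_mem (hT := h1) (r := ⟨_, h2⟩) hh).symm).trans
        (he.map_opp (Sum.inl h))).trans (congrArg _ (hf h))
    rw [hf] at h3
    by_cases hh' : f h ∈ T'
    · exact ⟨hh', Sum.inl_injective
        (h3.trans (cutMap_opp_of_mem (hT := h1') (r := ⟨_, h2'⟩) hh'))⟩
    · exact absurd (h3.trans (cutMap_opp_of_notMem (hT := h1') (r := ⟨_, h2'⟩) hh')) Sum.inl_ne_inr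
  have hr : ∀ h (hh : h ∉ T), ∃ hh', e (Sum.inr ⟨h, hh⟩) = Sum.inr ⟨f h, hh'⟩ := by
    intro h hh
    have h3 : e (Sum.inr ⟨h, hh⟩) = (N.cut O' T' h1' h2').opp (Sum.inl (f h)) :=
      ((congrArg e (cutMap_opp_of_notMem (hT := h1) (r := ⟨_, h2⟩) hh).symm).trans
        (he.map_opp (Sum.inl h))).trans (congrArg _ (hf h))
    by_cases hh' : f h ∈ T'
    · obtain ⟨y, hy⟩ := (hinr (Sum.inr ⟨h, hh⟩)).2 ⟨_, rfl⟩
      exact absurd (hy.symm.trans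
        (h3.trans (cutMap_opp_of_mem (hT := h1') (r := ⟨_, h2'⟩) hh'))) Sum.inr_ne_inl
    · exact ⟨hh', h3.trans (cutMap_opp_of_notMem (hT := h1') (r := ⟨_, h2'⟩) hh')⟩
  -- Outside `T` the edges of the map are no longer edges of the cut tree; they are recovered from
  -- the preserved matching.
  have hoppO : ∀ h ∈ O, h ∉ T → f (M.opp h) = N.opp (f h) := by
    intro h hhO hh
    obtain ⟨h4, h5⟩ := hr h hh
    obtain ⟨h6, h7⟩ := hr (M.opp h) ((h1 h).not.2 hh)
    obtain ⟨x, y, hxy, hy, -⟩ := (hp (Sum.inr ⟨h, hh⟩) (Sum.inr ⟨M.opp h, (h1 h).not.2 hh⟩)).2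
      ⟨⟨h, hh⟩, ⟨M.opp h, (h1 h).not.2 hh⟩, rfl, rfl, hhO⟩
    rw [h5, h7] at hxy
    obtain ⟨hx', hy'⟩ := Prod.ext_iff.1 hxy
    rw [← Sum.inr_injective hx', ← Sum.inr_injective hy'] at hy
    exact hy
  have hopp : ∀ h, f (M.opp h) = N.opp (f h) := by
    intro h
    by_cases hh : h ∈ T
    · exact (hT h hh).2
    by_cases hhO : h ∈ O
    · exact hoppO h hhO hh
    · have := hoppO (M.opp h) ((hO h).2 hhO) ((h1 h).not.2 hh)
      rw [M.opp_opp] at this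
      rw [this, N.opp_opp]
  have hmiff : ∀ h, h ∉ T → (f h ∈ N.marked ↔ h ∈ M.marked) := by
    intro h hh
    obtain ⟨h4, h5⟩ := hr h hh
    obtain ⟨h6, h7⟩ := hr (M.opp h) ((h1 h).not.2 hh)
    have h8 := hmk (Sum.inr ⟨h, hh⟩) (Sum.inr ⟨M.opp h, (h1 h).not.2 hh⟩)
    rw [h5, h7] at h8
    constructor
    · intro h9
      obtain ⟨x, y, hxy, -, hx⟩ := h8.1 ⟨⟨f h, h4⟩, ⟨f (M.opp h), h6⟩, rfl, hopp h, h9⟩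
      have := Sum.inr_injective (Prod.ext_iff.1 hxy).1
      rwa [← this] at hx
    · intro h9
      obtain ⟨x, y, hxy, -, hx⟩ := h8.2 ⟨_, _, rfl, rfl, h9⟩
      have := Sum.inr_injective (Prod.ext_iff.1 hxy).1
      rwa [← this] at hx
  refine ⟨Equiv.ofBijective f hbij, ⟨fun h => ?_, hopp, ?_⟩, fun h => ?_⟩
  · have := he.map_σ (Sum.inl h)
    rw [hf] at this
    exact Sum.inl_injective ((hf _).symm.trans this)
  · obtain ⟨h4, h5⟩ := hr M.root h2
    exact congrArg Subtype.val (Sum.inr_injective (h5.symm.trans he.map_root))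
  · by_cases hh : h ∈ T
    · exact ⟨fun h' => absurd (hT h hh).1 (hm' _ h'), fun h' => absurd hh (hm _ h')⟩
    · exact hmiff h hh

end MarkedMap

/-! ### Gluing matched leaves -/

theorem HalfEdgeMap.IsLeaf.eq_of_vert_eq {M : HalfEdgeMap} {l k : M.H} (hl : M.IsLeaf l)
    (h : M.vert k = M.vert l) : k = l := by
  obtain ⟨a, ha⟩ := Set.ncard_eq_one.1 hl
  have h1 : k ∈ ({a} : Set M.H) := ha ▸ h
  have h2 : l ∈ ({a} : Set M.H) := ha ▸ (rfl : M.vert l = M.vert l)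
  exact h1.trans h2.symm

theorem HalfEdgeMap.isLeaf_σ {M : HalfEdgeMap} (h : M.H) : M.IsLeaf (M.σ h) ↔ M.IsLeaf h := by
  rw [IsLeaf, vert_σ, IsLeaf]

namespace BlossomData

/-- The leaves of `t` are matched by `μ`, and no two of them are adjacent. -/
structure IsClosable (t : BlossomData) (μ : t.H → t.H) : Prop where
  not_isLeaf_opp : ∀ l, t.IsLeaf l → ¬ t.IsLeaf (t.opp l)
  isLeaf_partner : ∀ l, t.IsLeaf l → t.IsLeaf (μ l)
  partner_partner : ∀ l, t.IsLeaf l → μ (μ l) = l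
  partner_opening : ∀ l, t.IsLeaf l → (μ l ∈ t.opening ↔ l ∉ t.opening)
  mem_pairs : ∀ o c, (o, c) ∈ t.pairs ↔ o ∈ t.opening ∧ c = μ o
  leaf_of_opening : ∀ h ∈ t.opening, t.IsLeaf h
  root_opening : t.root ∈ t.opening
  marked_subset : t.marked ⊆ t.pairs

variable {t : BlossomData}

/-- Two adjacent leaves would be the whole connected tree. This is where the existence of a node is
needed. -/
theorem not_isLeaf_opp (ht : t.IsTree) (hn : ∃ v, t.IsNode v) {l : t.H} (hl : t.IsLeaf l) :
    ¬ t.IsLeaf (t.opp l) := by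
  intro hl'
  obtain ⟨v, hv⟩ := hn
  have key : ∀ {u}, t.Reaches Set.univ (t.vert l) u → u = t.vert l ∨ u = t.vert (t.opp l) := by
    intro u hu
    induction hu with
    | refl => exact .inl rfl
    | tail _ hs ih =>
      obtain ⟨k, -, rfl, rfl⟩ := hs
      rcases ih with h | h
      · rw [hl.eq_of_vert_eq h]
        exact .inr rfl
      · rw [hl'.eq_of_vert_eq h, t.opp_opp]
        exact .inl rfl
  rcases key (ht.connects _ v) with rfl | rfl
  · exact hv hl
  · exact hv hl'

theorem exists_isClosable (hB : t.IsBlossomingTree) (hM : t.IsMarkedMatching)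
    (hn : ∃ v, t.IsNode v) : ∃ μ, t.IsClosable μ := by
  classical
  choose! a ha ha' using hM.existsUnique_closing
  choose! b hb hb' using hM.existsUnique_opening
  have ha1 : ∀ o ∈ t.opening, a o ∈ t.closing := fun o ho => (hM.mem _ (ha o ho)).2
  have hb1 : ∀ c ∈ t.closing, b c ∈ t.opening := fun c hc => (hM.mem _ (hb c hc)).1
  have hba : ∀ o ∈ t.opening, b (a o) = o := fun o ho => (hb' _ (ha1 o ho) _ (ha o ho)).symm
  have hab : ∀ c ∈ t.closing, a (b c) = c := fun c hc => (ha' _ (hb1 c hc) _ (hb c hc)).symm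
  have ho : ∀ o ∈ t.opening, (if o ∈ t.opening then a o else b o) = a o := fun o ho => if_pos ho
  have hc : ∀ c ∈ t.closing, (if c ∈ t.opening then a c else b c) = b c := fun c hc => if_neg hc.2
  refine ⟨fun l => if l ∈ t.opening then a l else b l, fun l => not_isLeaf_opp hB.tree hn,
    fun l hl => ?_, fun l hl => ?_, fun l hl => ?_, fun o c => ?_, hB.leaf_of_opening,
    hB.root_opening, hM.marked_subset⟩
  · by_cases h : l ∈ t.opening
    · simpa only [ho l h] using (ha1 l h).1
    · simpa only [hc l ⟨hl, h⟩] using hB.leaf_of_opening _ (hb1 l ⟨hl, h⟩)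
  · by_cases h : l ∈ t.opening
    · simp only [ho l h]
      rw [hc _ (ha1 l h), hba l h]
    · simp only [hc l ⟨hl, h⟩]
      rw [ho _ (hb1 l ⟨hl, h⟩), hab l ⟨hl, h⟩]
  · by_cases h : l ∈ t.opening
    · simp only [ho l h]
      exact iff_of_false (ha1 l h).2 (not_not.2 h)
    · simp only [hc l ⟨hl, h⟩]
      exact iff_of_true (hb1 l ⟨hl, h⟩) h
  · constructor
    · intro h
      have h1 := (hM.mem _ h).1
      refine ⟨h1, ?_⟩
      simp only [ho o h1]
      exact ha' o h1 c h
    · rintro ⟨h1, rfl⟩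
      simp only [ho o h1]
      exact ha o h1

open Classical in
/-- The map obtained by gluing the matched leaves of a tree. -/
noncomputable def closeMap (t : BlossomData) (μ : t.H → t.H) (ht : t.IsClosable μ) :
    HalfEdgeMap where
  H := {h : t.H // ¬ t.IsLeaf h}
  finite := by
    have := t.finite
    infer_instance
  σ := t.σ.subtypePerm fun h => (isLeaf_σ h).not
  -- A half-edge carrying a leaf is joined to the half-edge that carries the partner leaf.
  opp h := if hl : t.IsLeaf (t.opp h.1) then
      ⟨t.opp (μ (t.opp h.1)), ht.not_isLeaf_opp _ (ht.isLeaf_partner _ hl)⟩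
    else ⟨t.opp h.1, hl⟩
  opp_opp := by
    rintro ⟨h, hh⟩
    by_cases hl : t.IsLeaf (t.opp h)
    · simp [hl, t.opp_opp, ht.isLeaf_partner _ hl, ht.partner_partner _ hl]
    · simp [hl, t.opp_opp, hh]
  opp_ne := by
    rintro ⟨h, hh⟩ he
    by_cases hl : t.IsLeaf (t.opp h)
    · simp only [hl, dite_true, Subtype.mk.injEq] at he
      -- A leaf is not its own partner, since exactly one leaf of a pair is opening.
      have h1 := ht.partner_opening _ hl
      have h2 : μ (t.opp h) = t.opp h := opp_eq_comm.1 he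
      rw [h2] at h1
      exact (iff_not_self h1)
    · simp only [hl, dite_false, Subtype.mk.injEq] at he
      exact t.opp_ne h he
  root := ⟨t.opp t.root, ht.not_isLeaf_opp _ (ht.leaf_of_opening _ ht.root_opening)⟩

section Close

variable {μ : t.H → t.H} {ht : t.IsClosable μ}

/-- The half-edges of the edges of the closed map that come from edges of the tree. -/
def innerEdges (t : BlossomData) (μ : t.H → t.H) (ht : t.IsClosable μ) :
    Set (t.closeMap μ ht).H := {h | ¬ t.IsLeaf (t.opp h.1)}

theorem closeMap_opp_of_mem {h : (t.closeMap μ ht).H} (hh : h ∈ t.innerEdges μ ht) :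
    ((t.closeMap μ ht).opp h).1 = t.opp h.1 :=
  congrArg Subtype.val (dif_neg hh)

theorem closeMap_opp_of_notMem {h : (t.closeMap μ ht).H} (hh : h ∉ t.innerEdges μ ht) :
    ((t.closeMap μ ht).opp h).1 = t.opp (μ (t.opp h.1)) :=
  congrArg Subtype.val (dif_pos (not_not.1 hh))

theorem opp_mem_innerEdges (h : (t.closeMap μ ht).H) :
    (t.closeMap μ ht).opp h ∈ t.innerEdges μ ht ↔ h ∈ t.innerEdges μ ht := by
  by_cases hh : h ∈ t.innerEdges μ ht
  · refine iff_of_true ?_ hh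
    change ¬ t.IsLeaf (t.opp _)
    rw [closeMap_opp_of_mem hh, t.opp_opp]
    exact h.2
  · refine iff_of_false ?_ hh
    change ¬ ¬ t.IsLeaf (t.opp _)
    rw [closeMap_opp_of_notMem hh, t.opp_opp, not_not]
    exact ht.isLeaf_partner _ (not_not.1 hh)

theorem root_notMem_innerEdges : (t.closeMap μ ht).root ∉ t.innerEdges μ ht := by
  change ¬ ¬ t.IsLeaf (t.opp (t.opp t.root))
  rw [t.opp_opp, not_not]
  exact ht.leaf_of_opening _ ht.root_opening

/-- Cutting the edges of the closed map that do not come from the tree gives the tree back. -/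
noncomputable def cutCloseEquiv (t : BlossomData) (μ : t.H → t.H) (ht : t.IsClosable μ) :
    (t.closeMap μ ht).H ⊕ {h : (t.closeMap μ ht).H // h ∉ t.innerEdges μ ht} ≃ t.H :=
  Equiv.ofBijective (Sum.elim (fun h => h.1) fun x => t.opp x.1.1) <| by
    constructor
    · rintro (x | x) (y | y) hxy
      · exact congrArg Sum.inl (Subtype.ext hxy)
      · refine absurd (not_not.1 y.2) ?_
        change x.1 = t.opp y.1.1 at hxy
        rw [← hxy]
        exact x.2
      · refine absurd (not_not.1 x.2) ?_
        change t.opp x.1.1 = y.1 at hxy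
        rw [hxy]
        exact y.2
      · exact congrArg Sum.inr (Subtype.ext (Subtype.ext (t.opp_injective hxy)))
    · intro h
      by_cases hl : t.IsLeaf h
      · refine ⟨Sum.inr ⟨⟨t.opp h, ht.not_isLeaf_opp _ hl⟩, ?_⟩, t.opp_opp h⟩
        change ¬ ¬ t.IsLeaf (t.opp (t.opp h))
        rwa [t.opp_opp, not_not]
      · exact ⟨Sum.inl ⟨h, hl⟩, rfl⟩

theorem isIso_cutCloseEquiv : HalfEdgeMap.IsIso ((t.closeMap μ ht).cutMap (t.innerEdges μ ht)
    opp_mem_innerEdges ⟨_, root_notMem_innerEdges⟩) t.toHalfEdgeMap (t.cutCloseEquiv μ ht) where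
  map_σ := by
    rintro (x | x)
    · rfl
    · exact ((not_not.1 x.2).eq_of_vert_eq (vert_σ _)).symm
  map_opp := by
    rintro (x | x)
    · by_cases hx : x ∈ t.innerEdges μ ht
      · exact (congrArg (t.cutCloseEquiv μ ht) (cutMap_opp_of_mem hx)).trans
          (closeMap_opp_of_mem hx)
      · exact congrArg (t.cutCloseEquiv μ ht) (cutMap_opp_of_notMem hx)
    · exact (t.opp_opp _).symm
  map_root := t.opp_opp t.root

theorem isSpanningTree_innerEdges (hB : t.IsTree) :
    (t.closeMap μ ht).IsSpanningTree (t.innerEdges μ ht) :=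
  cutMap_isTree_iff.1 (isIso_cutCloseEquiv.symm.isSpanningTree (fun _ => by simp) hB)

theorem closeMap_degree (h : (t.closeMap μ ht).H) :
    (t.closeMap μ ht).degree ((t.closeMap μ ht).vert h) = t.degree (t.vert h.1) := by
  rw [← cutMap_degree_inl (T := t.innerEdges μ ht) (hT := opp_mem_innerEdges)
    (r := ⟨_, root_notMem_innerEdges⟩), ← isIso_cutCloseEquiv.degree_vertexEquiv]
  rfl

theorem isEulerian_closeMap (hE : t.IsEulerianTree) : (t.closeMap μ ht).IsEulerian := by
  intro v
  obtain ⟨h, rfl⟩ := (t.closeMap μ ht).vert_surjective v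
  obtain ⟨k, hk, -⟩ := hE (t.vert h.1) h.2
  rw [closeMap_degree, hk]
  exact even_two_mul k

/-- The marked map obtained by gluing the matched leaves of a marked blossoming tree. -/
noncomputable def closeMarked (t : BlossomData) (μ : t.H → t.H) (ht : t.IsClosable μ)
    (hB : t.IsTree) : MarkedMap where
  toHalfEdgeMap := t.closeMap μ ht
  connected u v := ((isSpanningTree_innerEdges hB).connects u v).mono (Set.subset_univ _)
  marked := {h | (t.opp h.1, μ (t.opp h.1)) ∈ t.marked}
  opp_notMem_marked h hh h' := by
    have h1 := ((ht.mem_pairs _ _).1 (ht.marked_subset hh)).1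
    have hl := ht.leaf_of_opening _ h1
    have h2 := ((ht.mem_pairs _ _).1 (ht.marked_subset h')).1
    rw [closeMap_opp_of_notMem (not_not.2 hl), t.opp_opp, ht.partner_opening _ hl] at h2
    exact h2 h1

/-- The orientation of the closed map: matched pairs are directed from the opening leaf to the
closing leaf, and the edges of `P` are directed by `P`. -/
def closeOrientation (t : BlossomData) (μ : t.H → t.H) (ht : t.IsClosable μ)
    (P : Set (t.closeMap μ ht).H) : Set (t.closeMap μ ht).H := {h | t.opp h.1 ∈ t.opening ∨ h ∈ P}

end Close

end BlossomData

namespace BlossomData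

section CloseProperties

variable {t : BlossomData} {μ : t.H → t.H} {ht : t.IsClosable μ} {P : Set (t.closeMap μ ht).H}

theorem closeOrientation_isOrientation (hP : ∀ h ∈ P, (t.closeMap μ ht).opp h ∉ P)
    (hPT : (t.closeMap μ ht).edgesOf P = t.innerEdges μ ht) :
    (t.closeMap μ ht).IsOrientation (t.closeOrientation μ ht P) := by
  intro h
  by_cases hh : h ∈ t.innerEdges μ ht
  · have h1 : t.opp h.1 ∉ t.opening := fun h' => hh (ht.leaf_of_opening _ h')
    have h2 : t.opp ((t.closeMap μ ht).opp h).1 ∉ t.opening := fun h' =>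
      (opp_mem_innerEdges h).2 hh (ht.leaf_of_opening _ h')
    have h3 : h ∈ P ∨ (t.closeMap μ ht).opp h ∈ P := by
      rw [← hPT] at hh
      exact hh
    have h4 := hP h
    change (t.opp ((t.closeMap μ ht).opp h).1 ∈ t.opening ∨ (t.closeMap μ ht).opp h ∈ P) ↔
      ¬ (t.opp h.1 ∈ t.opening ∨ h ∈ P)
    tauto
  · have h1 : h ∉ P := fun h' => hh (hPT ▸ .inl h')
    have h2 : (t.closeMap μ ht).opp h ∉ P := fun h' => hh (hPT ▸ .inr h')
    have h3 := ht.partner_opening _ (not_not.1 hh)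
    change (t.opp ((t.closeMap μ ht).opp h).1 ∈ t.opening ∨ (t.closeMap μ ht).opp h ∈ P) ↔
      ¬ (t.opp h.1 ∈ t.opening ∨ h ∈ P)
    rw [closeMap_opp_of_notMem hh, t.opp_opp]
    tauto

/-- Cutting the closed map gives the blossoming tree back. -/
theorem cut_close_isomorphic (hB : t.IsTree)
    (hPT : (t.closeMap μ ht).edgesOf P = t.innerEdges μ ht) :
    ∃ e, HalfEdgeMap.IsIso ((t.closeMarked μ ht hB).cut (t.closeOrientation μ ht P)
        (t.innerEdges μ ht) opp_mem_innerEdges root_notMem_innerEdges).toHalfEdgeMap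
        t.toHalfEdgeMap e ∧
      (∀ h, e h ∈ t.opening ↔ h ∈ ((t.closeMarked μ ht hB).cut (t.closeOrientation μ ht P)
        (t.innerEdges μ ht) opp_mem_innerEdges root_notMem_innerEdges).opening) ∧
      (∀ o c, (e o, e c) ∈ t.pairs ↔
        (o, c) ∈ ((t.closeMarked μ ht hB).cut (t.closeOrientation μ ht P)
        (t.innerEdges μ ht) opp_mem_innerEdges root_notMem_innerEdges).pairs) ∧
      (∀ o c, (e o, e c) ∈ t.marked ↔
        (o, c) ∈ ((t.closeMarked μ ht hB).cut (t.closeOrientation μ ht P)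
        (t.innerEdges μ ht) opp_mem_innerEdges root_notMem_innerEdges).marked) ∧
      ∀ h, e (Sum.inl h) = h.1 := by
  have hop : ∀ h, t.cutCloseEquiv μ ht h ∈ t.opening ↔ ∃ x, h = Sum.inr x ∧
      t.opp x.1.1 ∈ t.opening := by
    rintro (x | x)
    · refine iff_of_false (fun h => x.2 (ht.leaf_of_opening _ h)) ?_
      rintro ⟨y, hy, -⟩
      exact Sum.inl_ne_inr hy
    · constructor
      · exact fun h => ⟨x, rfl, h⟩
      · rintro ⟨y, hy, h⟩
        obtain rfl := Sum.inr_injective hy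
        exact h
  have hO : ∀ x : {h : (t.closeMap μ ht).H // h ∉ t.innerEdges μ ht},
      x.1 ∈ t.closeOrientation μ ht P ↔ t.opp x.1.1 ∈ t.opening := fun x =>
    or_iff_left fun h => x.2 (hPT.subset (.inl h))
  have hpair : ∀ o c, (t.cutCloseEquiv μ ht o, t.cutCloseEquiv μ ht c) ∈ t.pairs ↔
      ∃ h k, (o, c) = (Sum.inr h, Sum.inr k) ∧ k.1 = (t.closeMap μ ht).opp h.1 ∧
        t.opp h.1.1 ∈ t.opening := by
    intro o c
    rw [ht.mem_pairs, hop]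
    constructor
    · rintro ⟨⟨x, rfl, hx⟩, hc⟩
      change t.cutCloseEquiv μ ht c = μ (t.opp x.1.1) at hc
      have hl := ht.isLeaf_partner _ (ht.leaf_of_opening _ hx)
      rw [← hc] at hl
      rcases c with c | c
      · exact absurd hl c.2
      · refine ⟨x, c, rfl, Subtype.ext ?_, hx⟩
        rw [closeMap_opp_of_notMem x.2, ← hc]
        exact (t.opp_opp _).symm
    · rintro ⟨x, y, hxy, h1, h2⟩
      obtain ⟨rfl, rfl⟩ := Prod.mk.inj hxy
      refine ⟨⟨x, rfl, h2⟩, ?_⟩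
      change t.opp y.1.1 = μ (t.opp x.1.1)
      rw [h1, closeMap_opp_of_notMem x.2, t.opp_opp]
  refine ⟨t.cutCloseEquiv μ ht, isIso_cutCloseEquiv, fun h => ?_, fun o c => ?_, fun o c => ?_,
    fun _ => rfl⟩
  · refine (hop h).trans ?_
    exact exists_congr fun x => and_congr_right fun _ => (hO x).symm
  · refine (hpair o c).trans ?_
    exact exists_congr fun x => exists_congr fun y => and_congr_right fun _ =>
      and_congr_right fun _ => (hO x).symm
  · constructor
    · intro h
      obtain ⟨x, y, hxy, h1, h2⟩ := (hpair o c).1 (ht.marked_subset h)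
      refine ⟨x, y, hxy, h1, ?_⟩
      have := ((ht.mem_pairs _ _).1 (ht.marked_subset h)).2
      rw [this] at h
      obtain ⟨rfl, rfl⟩ := Prod.mk.inj hxy
      exact h
    · rintro ⟨x, y, hxy, h1, h2⟩
      have h3 := ht.marked_subset h2
      have h4 := (hpair o c).2 ⟨x, y, hxy, h1, ((ht.mem_pairs _ _).1 h3).1⟩
      have h5 := ((ht.mem_pairs _ _).1 h4).2
      obtain ⟨rfl, rfl⟩ := Prod.mk.inj hxy
      exact (congrArg (fun z => (t.opp x.1.1, z) ∈ t.marked) h5).mpr h2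

/-- The map obtained by gluing the matched leaves of a marked Eulerian tree is Eulerian, it comes
with a canonical pair that allows one to recover the tree, and its root half-edge is outgoing. -/
theorem exists_closed (t : BlossomData) (hB : t.IsBlossomingTree) (hE : t.IsEulerianTree)
    (hM : t.IsMarkedMatching) (hn : ∃ v, t.IsNode v) :
    ∃ (M : MarkedMap) (O T : Set M.H), M.IsEulerian ∧ M.IsCanonical M.halfDegree O T ∧
      M.root ∈ O ∧ M.CutsInto O T t ∧ M.marked.ncard = t.marked.ncard := by
  obtain ⟨μ, ht⟩ := exists_isClosable hB hM hn
  have hsp := isSpanningTree_innerEdges (ht := ht) hB.tree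
  -- `P` directs the inner edges to the root vertex; by counting, its edges are all the inner edges.
  obtain ⟨P, hPT, hP, hr, hcard⟩ := exists_parents fun v => hsp.connects v _
  have hPT' : (t.closeMap μ ht).edgesOf P = t.innerEdges μ ht := by
    refine Set.eq_of_subset_of_ncard_le ?_ ?_
    · rintro h (hh | hh)
      · exact hPT hh
      · exact (opp_mem_innerEdges h).1 (hPT hh)
    · have := hsp.card_eq
      rw [ncard_edgesOf hP]
      omega
  set M := t.closeMarked μ ht hB.tree with hMdef
  set T : Set M.H := t.innerEdges μ ht with hTdef
  set O : Set M.H := t.closeOrientation μ ht P with hOdef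
  have hO : M.IsOrientation O := closeOrientation_isOrientation hP hPT'
  have hME : M.IsEulerian := isEulerian_closeMap (ht := ht) hE
  have hrO : M.root ∈ O := .inl (by
    change t.opp (t.opp t.root) ∈ _
    rw [t.opp_opp]
    exact hB.root_opening)
  have hPO : P ⊆ T ∩ O := fun h hh => ⟨hPT hh, .inr hh⟩
  have hint : ∀ v, M.Reaches (T ∩ O) v M.rootVertex := fun v => (hr v).mono hPO
  have hR : M.IsRootedTree O T := ⟨hO, hsp, hint⟩
  have hTopp : ∀ h, M.opp h ∈ T ↔ h ∈ T := opp_mem_innerEdges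
  have hrT : M.root ∉ T := root_notMem_innerEdges
  have hmO : ∀ h ∈ M.marked, t.opp h.1 ∈ t.opening := fun h hh =>
    ((ht.mem_pairs _ _).1 (ht.marked_subset hh)).1
  have hmT : ∀ h ∈ M.marked, h ∉ T := fun h hh hhT =>
    hhT (ht.leaf_of_opening _ (hmO h hh))
  obtain ⟨e, he, heo, hep, hem, hel⟩ := cut_close_isomorphic (μ := μ) hB.tree hPT'
  -- The forward condition on unmarked pairs, transported to the walk around `T`. It gives one
  -- direction of the external rule; the other follows because only one half of an edge can be
  -- visited before the other.
  have hext : ∀ h, h ∉ T → h ∉ M.markedHalfEdges → h ∈ O →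
      VisitedBefore (M.walk T) M.root h (M.opp h) := by
    intro h hh hm hhO
    have h1 := (hep (Sum.inr ⟨h, hh⟩) (Sum.inr ⟨M.opp h, (hTopp h).not.2 hh⟩)).2
      ⟨_, _, rfl, rfl, hhO⟩
    have h2 := hM.forward _ h1 fun h3 => by
      obtain ⟨x, y, hxy, -, hx⟩ := (hem _ _).1 h3
      have := Sum.inr_injective (Prod.ext_iff.1 hxy).1
      rw [← this] at hx
      exact hm (.inl hx)
    have h2 := (he.visitedBefore_walk_iff (T := Set.univ) (T' := Set.univ)
      (fun _ => iff_of_true trivial trivial) _ _).1 h2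
    exact (cutMap_visitedBefore_iff (hT := hTopp) (r := ⟨_, hrT⟩) ⟨h, hh⟩
      ⟨M.opp h, (hTopp h).not.2 hh⟩).1 h2
  have hcan : M.IsCanonical M.halfDegree O T := by
    refine ⟨⟨hO, fun v => ?_⟩, fun h hh => .inl (hmO h hh), hsp, ?_, hint, fun h hh hm => ?_⟩
    · obtain ⟨h, rfl⟩ := M.vert_surjective v
      obtain ⟨k, hk, hk'⟩ := hE (t.vert h.1) h.2
      have hd : M.degree (M.vert h) = t.degree (t.vert h.1) := closeMap_degree (ht := ht) h
      -- The `k - 1` opening leaves of the node and the one extra outgoing half-edge make outdegree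
      -- `k`, half of the degree.
      rw [halfDegree, hd, hk, hR.outDegree_eq hrO, ← M.ncard_opening_cut (hT := hTopp) (hr := hrT),
        ← Set.ncard_image_of_injective _ e.injective, Nat.mul_div_cancel_left _ two_pos, ← hk']
      congr 2
      ext x
      obtain ⟨y, rfl⟩ := e.surjective x
      rw [e.injective.mem_set_image, Set.mem_ofPred_eq, Set.mem_ofPred_eq, heo, ← he.map_root,
        e.injective.ne_iff, ← he.map_opp, ← hel, ← he.vertexEquiv_vert]
      exact and_congr_right fun _ => and_congr_right fun _ =>
        (he.vertexEquiv.apply_eq_iff_eq (y := Quotient.mk _ (Sum.inl h))).symm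
    · refine Set.disjoint_left.2 ?_
      rintro h hh (hm | hm)
      · exact hmT h hm hh
      · exact hmT _ hm ((hTopp h).2 hh)
    · refine ⟨hext h hh hm, fun hv => ?_⟩
      by_contra hhO
      have := hext (M.opp h) ((hTopp h).not.2 hh)
        (fun h' => hm (MarkedMap.opp_mem_markedHalfEdges.1 h')) ((hO h).2 hhO)
      rw [M.opp_opp] at this
      exact this.asymm hv
  refine ⟨M, O, T, hME, hcan, hrO, ⟨hTopp, hrT, e, he, heo, hep, hem⟩, ?_⟩
  rw [← MarkedMap.ncard_marked_cut (hT := hTopp) (hr := hrT) hcan,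
    ← Set.ncard_image_of_injective _ (e.prodCongr e).injective]
  congr 1
  ext p
  obtain ⟨⟨x, y⟩, rfl⟩ := (e.prodCongr e).surjective p
  rw [(e.prodCongr e).injective.mem_set_image]
  exact (hem x y).symm

end CloseProperties

end BlossomData

/-! ### Assembling the bijection on isomorphism classes -/

namespace BlossomData.Isomorphic

variable {s t u : BlossomData}

theorem refl (t : BlossomData) : t.Isomorphic t :=
  ⟨Equiv.refl _, .refl _, fun _ => Iff.rfl, fun _ _ => Iff.rfl, fun _ _ => Iff.rfl⟩

theorem symm (h : s.Isomorphic t) : t.Isomorphic s := by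
  obtain ⟨e, h, k, l, m⟩ := h
  exact ⟨e.symm, h.symm, fun x => by
    rw [← k, Equiv.apply_symm_apply], fun o c => by
    rw [← l, Equiv.apply_symm_apply, Equiv.apply_symm_apply], fun o c => by
    rw [← m, Equiv.apply_symm_apply, Equiv.apply_symm_apply]⟩

theorem trans (h : s.Isomorphic t) (h' : t.Isomorphic u) : s.Isomorphic u := by
  obtain ⟨e, h, k, l, m⟩ := h
  obtain ⟨f, h2, k2, l2, m2⟩ := h'
  exact ⟨e.trans f, h.trans h2, fun x => by
    rw [Equiv.trans_apply, k2, k], fun o c => by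
    rw [Equiv.trans_apply, Equiv.trans_apply, l2, l], fun o c => by
    rw [Equiv.trans_apply, Equiv.trans_apply, m2, m]⟩

end BlossomData.Isomorphic

namespace MarkedMap

variable {M : MarkedMap} {O T : Set M.H}

theorem IsCanonical.root_mem_of_isAdmissible (h : M.IsCanonical M.halfDegree O T)
    (ha : M.IsAdmissible) : M.root ∉ T ∧ M.root ∈ O := by
  obtain ⟨O', h1, h2, -, h3⟩ := ha
  exact h.root_mem h1 h2 h3

theorem IsCanonical.isAdmissible (h : M.IsCanonical M.halfDegree O T) (hr : M.root ∈ O) :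
    M.IsAdmissible := by
  have hsub : T ∩ O ⊆ O \ M.markedHalfEdges := fun k hk =>
    ⟨hk.2, Set.disjoint_left.1 h.unmarked hk.1⟩
  exact ⟨O, h.alpha, h.compatible, fun v => (h.internal v).mono hsub, hr⟩

theorem IsCanonical.notMem_of_marked (h : M.IsCanonical M.halfDegree O T) :
    ∀ k ∈ M.marked, k ∉ T := fun _ hk hkT => Set.disjoint_left.1 h.unmarked hkT (.inl hk)

end MarkedMap

namespace AdmissibleMap

variable {a : ℕ}

theorem exists_isCanonical (M : AdmissibleMap a) :
    ∃ p : Set M.1.H × Set M.1.H, M.1.IsCanonical M.1.halfDegree p.1 p.2 := by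
  obtain ⟨O, h1, h2, h3, -⟩ := M.2.2.1
  obtain ⟨O', T, h⟩ := MarkedMap.exists_isCanonical h1 h2 h3
  exact ⟨(O', T), h⟩

/-- By uniqueness the tree cut along one canonical pair serves for every canonical pair.
Admissibility guarantees that the root half-edge is external and outgoing, so that the cut tree has
an opening root leaf. -/
theorem exists_cutTree (M : AdmissibleMap a) : ∃ s : MarkedEulerianTree a,
    ∀ O T, M.1.IsCanonical M.1.halfDegree O T → M.1.CutsInto O T s.1 := by
  obtain ⟨⟨O, T⟩, h⟩ := M.exists_isCanonical
  obtain ⟨hrT, hrO⟩ := h.root_mem_of_isAdmissible M.2.2.1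
  refine ⟨⟨M.1.cut O T h.spanning.opp_mem_iff hrT,
    MarkedMap.isBlossomingTree_cut M.2.1 h.alpha.1 h.spanning hrO,
    MarkedMap.isEulerianTree_cut M.2.1 h hrO, MarkedMap.isMarkedMatching_cut M.2.1 h,
    MarkedMap.isNode_cut M.2.1, (MarkedMap.ncard_marked_cut h).trans M.2.2.2⟩, ?_⟩
  intro O' T' h'
  obtain ⟨rfl, rfl⟩ := h.unique h'
  exact ⟨h.spanning.opp_mem_iff, hrT, .refl _⟩

end AdmissibleMap

theorem MarkedMap.CutsInto.isomorphic_iff {M : MarkedMap} {O T : Set M.H} {s t : BlossomData}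
    (hs : M.CutsInto O T s) : s.Isomorphic t ↔ M.CutsInto O T t := by
  obtain ⟨h1, h2, h⟩ := hs
  refine ⟨fun ht => ⟨h1, h2, h.trans ht⟩, ?_⟩
  rintro ⟨h1', h2', ht⟩
  exact h.symm.trans ht

theorem MarkedMap.CutsInto.of_isIso {M N : MarkedMap} {e : M.H ≃ N.H}
    (he : HalfEdgeMap.IsIso M.toHalfEdgeMap N.toHalfEdgeMap e)
    (hm : ∀ h, e h ∈ N.marked ↔ h ∈ M.marked) {O T : Set M.H} {t : BlossomData}
    (ht : N.CutsInto (e '' O) (e '' T) t) : M.CutsInto O T t := by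
  obtain ⟨h1, h2, h⟩ := ht
  have h1' : ∀ h, M.opp h ∈ T ↔ h ∈ T := fun k => by
    rw [← e.injective.mem_set_image, he.map_opp, h1, e.injective.mem_set_image]
  have h2' : M.root ∉ T := by
    rwa [← e.injective.mem_set_image, he.map_root]
  exact ⟨h1', h2', (MarkedMap.cut_isomorphic_of_isIso he hm
    (fun _ => e.injective.mem_set_image) (fun _ => e.injective.mem_set_image) h1' h2' h1 h2).trans h⟩

/-- One direction shows that cutting is well defined on isomorphism classes, since an isomorphism
carries the canonical pair to a canonical pair; the other shows that it is injective. -/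
theorem AdmissibleMap.isomorphic_iff {a : ℕ} {M N : AdmissibleMap a} {s t : BlossomData}
    (hs : ∀ O T, M.1.IsCanonical M.1.halfDegree O T → M.1.CutsInto O T s)
    (ht : ∀ O T, N.1.IsCanonical N.1.halfDegree O T → N.1.CutsInto O T t) :
    s.Isomorphic t ↔ M.1.Isomorphic N.1 := by
  obtain ⟨⟨O, T⟩, hM⟩ := M.exists_isCanonical
  constructor
  · intro h
    obtain ⟨⟨O', T'⟩, hN⟩ := N.exists_isCanonical
    obtain ⟨_, _, h1⟩ := hs _ _ hM
    obtain ⟨_, _, h2⟩ := ht _ _ hN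
    exact MarkedMap.isomorphic_of_cut M.2.1 N.2.1 hM.alpha.1 hM.notMem_of_marked
      hN.notMem_of_marked ((h1.trans h).trans h2.symm)
  · rintro ⟨e, he, hm⟩
    have hN := hM.of_isIso he hm (O' := e '' O) (T' := e '' T)
      (fun _ => e.injective.mem_set_image) (fun _ => e.injective.mem_set_image)
    exact (hs O T hM).isomorphic_iff.2 (.of_isIso he hm (ht _ _ hN))

theorem mainTheorem8 (a : ℕ) :
    (∀ M : AdmissibleMap a, ∃! p : Set M.1.H × Set M.1.H,
      M.1.IsCanonical M.1.halfDegree p.1 p.2) ∧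
    ∃ Ψ : Quotient (MarkedEulerianTree.setoid a) ≃ Quotient (AdmissibleMap.setoid a),
      (∀ (t : MarkedEulerianTree a) (M : AdmissibleMap a) (O T : Set M.1.H),
        M.1.IsCanonical M.1.halfDegree O T →
          (Ψ (Quotient.mk _ t) = Quotient.mk _ M ↔ M.1.CutsInto O T t.1)) ∧
      ∀ (t : MarkedEulerianTree a) (M : AdmissibleMap a),
        Ψ (Quotient.mk _ t) = Quotient.mk _ M →
          ∀ k : ℕ, t.1.nodeCount (2 * k) = M.1.vertexCount (2 * k) := by
  refine ⟨fun M => ?_, ?_⟩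
  · obtain ⟨p, hp⟩ := M.exists_isCanonical
    refine ⟨p, hp, fun q hq => ?_⟩
    obtain ⟨h1, h2⟩ := MarkedMap.IsCanonical.unique hq hp
    exact Prod.ext h1 h2
  choose φ hφ using AdmissibleMap.exists_cutTree (a := a)
  -- The bijection is constructed in the direction of cutting, whose surjectivity is provided by
  -- gluing, and is then inverted.
  let Φ : Quotient (AdmissibleMap.setoid a) → Quotient (MarkedEulerianTree.setoid a) :=
    Quotient.map φ fun M N h => (AdmissibleMap.isomorphic_iff (hφ M) (hφ N)).2 h
  have hΦ : Function.Bijective Φ := by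
    constructor
    · intro x y
      induction x, y using Quotient.inductionOn₂ with
      | h M N =>
      intro h
      exact Quotient.sound ((AdmissibleMap.isomorphic_iff (hφ M) (hφ N)).1 (Quotient.exact h))
    · intro x
      induction x using Quotient.inductionOn with
      | h t =>
      obtain ⟨t, hB, hE, hM, hn, hc⟩ := t
      obtain ⟨M, O, T, h1, h2, h3, h4, h5⟩ := BlossomData.exists_closed t hB hE hM hn
      refine ⟨Quotient.mk _ ⟨M, h1, h2.isAdmissible h3, h5.trans hc⟩, Quotient.sound ?_⟩
      exact (hφ ⟨M, h1, h2.isAdmissible h3, h5.trans hc⟩ O T h2).isomorphic_iff.2 h4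
  have key : ∀ (t : MarkedEulerianTree a) (M : AdmissibleMap a) (O T : Set M.1.H),
      M.1.IsCanonical M.1.halfDegree O T → ((Equiv.ofBijective Φ hΦ).symm (Quotient.mk _ t) =
        Quotient.mk _ M ↔ M.1.CutsInto O T t.1) := by
    intro t M O T h
    rw [Equiv.symm_apply_eq, ← (hφ M O T h).isomorphic_iff]
    constructor
    · exact fun h => Quotient.exact h.symm
    · exact fun h => (Quotient.sound h).symm
  refine ⟨(Equiv.ofBijective Φ hΦ).symm, key, fun t M h k => ?_⟩
  obtain ⟨⟨O, T⟩, hM⟩ := M.exists_isCanonical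
  -- The degree `2 * k` is never 1, so the new leaves do not interfere with the count.
  exact MarkedMap.nodeCount_eq_of_cutsInto ((key t M O T hM).1 h) (by omega)
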